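/- Let $\mathbb K\in\{\mathbb R,\mathbb C\}$, let $k\ge 2$, $i\in\{1,\dots,k-1\}$, put $q:=2k-i$, and let $M\in\mathbb R$. There are $\delta>0$ and $\rho>0$, depending only on $\mathbb K,k,i,M$, such that the following holds. Let $B,\bar B$ be Banach spaces over $\mathbb K$, let $m\in\{1,2,\dots,\infty\}$, let $G\in C^{m+q}(B,\bar B)$, let $U\subset\mathbb K$ be an open neighbourhood of $0$ and $z\in C^{m+q}(U,B)$ with $z(0)=0$ (for $\mathbb K=\mathbb C$ these maps are holomorphic). Put $L(\varepsilon):=G'[z(\varepsilon)]$. *$k$-surjectivity.* Assume that for every $\bar y\in\bar B$ there is a curve $b(\varepsilon)=b_0+\varepsilon b_1+\dots+\varepsilon^k b_k$ in $B$ with $L(\varepsilon)b(\varepsilon)=\varepsilon^k\bar y+O(\varepsilon^{k+1})$. *Direct sums.* Let $B=N_1^c\oplus\dots\oplus N_{k+1}^c\oplus N_{k+1}$ and $\bar B=R_1\oplus\dots\oplus R_{k+1}$ be direct sums of closed subspaces obtained from Jordan chains of increasing rank. This means the following. For $j=0,\dots,k$, $N_{j+1}^c\oplus\dots\oplus N_{k+1}^c\oplus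 N_{k+1}$ is the space of all $b_0\in B$ of rank at least $j$, i.e. for which there is a curve $b(\varepsilon)=b_0+\varepsilon b_1+\dots+\varepsilon^jb_j$ with $L(\varepsilon)b(\varepsilon)=O(\varepsilon^j)$. The space $N_{k+1}$ consists of all elements of rank at least $k+1$. For $j=0,\dots,k$, $R_1\oplus\dots\oplus R_{j+1}$ is the space of leading coefficients of order $j$, i.e. of all $\bar y\in\bar B$ with $L(\varepsilon)b(\varepsilon)=\varepsilon^j\bar y+O(\varepsilon^{j+1})$ for some curve $b(\varepsilon)=b_0+\dots+\varepsilon^jb_j$. Let $\mathcal P_{k+1}$ be the projection of $\bar B$ to $R_{k+1}$ along $R_1\oplus\dots\oplus R_k$. *Assumptions on $G$ and $z$.* Assume $G^{(2)}[0]=\dots=G^{(i+1)}[0]=0$ and $G[z(\varepsilon)]=\varepsilon^{q}\,\bar b(\varepsilon)$ for $\varepsilon\in U$, with $\bar b$ continuous at $0$. Then there exist bounded operators $\phi_1,\dots,\phi_k\in L[B,B]$ with $\phi_j(B)\subset N_1^c\oplus\dots\oplus N_{k+1-j}^c$ and linear homeomorphisms $S_{j}:N_{j}^c\to R_{j}$,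 $j=1,\dots,k+1$, such that $p_k(\varepsilon):=I_B+\varepsilon\phi_1+\dots+\varepsilon^k\phi_k$ satisfies $$L(\varepsilon)p_k(\varepsilon)n=\varepsilon^{j}S_{j+1}n+O(\varepsilon^{j+1})\quad(n\in N_{j+1}^c,\ 0\le j\le k),\qquad L(\varepsilon)p_k(\varepsilon)n=O(\varepsilon^{k+1})\quad(n\in N_{k+1}).$$ For every such choice of $\phi_j,S_j$ the following holds. For $n_j^c\in N_j^c$ and $n_{k+1}\in N_{k+1}$ consider the points $$Z(\varepsilon,n_1^c,\dots,n_{k+1}^c,n_{k+1}):=z(\varepsilon)+\varepsilon^{k-i}\,p_k(\varepsilon)\{\varepsilon^kn_1^c+\dots+\varepsilon n_k^c+n_{k+1}^c+n_{k+1}\}$$ of the generalized cone. If $\|z'(0)\|$, $\|G^{(i+2)}[0]\|$, $\|\mathcal P_{k+1}\|$ and $\|S_{k+1}^{-1}\|$ are at most $M$ and $$\|\mathcal P_{k+1}\bar b(0)\|<\delta,$$ then there are $\eta>0$ with $\{|\varepsilon|<\eta\}\subset U$ and a $C^m$ map $(\bar n_1^c,\dots,\bar n_{k+1}^c)(\varepsilon,n_{k+1})\in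 N_1^c\times\dots\times N_{k+1}^c$, defined for $|\varepsilon|<\eta$, $\|n_{k+1}\|<\rho$, such that: 1. for all these $(\varepsilon,n_{k+1})$ one has $\|\bar n_{k+1}^c(\varepsilon,n_{k+1})\|<\rho$, and, with $\bar n^c:=\varepsilon^k\bar n_1^c+\dots+\varepsilon\bar n_k^c+\bar n_{k+1}^c$, the point $z(\varepsilon)+\varepsilon^{k-i}p_k(\varepsilon)\{\bar n^c(\varepsilon,n_{k+1})+n_{k+1}\}$ is a solution of $G[z]=0$; 2. these are all the solutions in the cone: for every $C>0$ there is $\eta'\in(0,\eta]$ such that for $0<|\varepsilon|<\eta'$, $\|n_{k+1}\|<\rho$, $\|n_{k+1}^c\|<\rho$ and $\|n_1^c\|,\dots,\|n_{k+1}^c\|\le C$ one has $$G[Z(\varepsilon,n_1^c,\dots,n_{k+1}^c,n_{k+1})]=0\iff n_j^c=\bar n_j^c(\varepsilon,n_{k+1})\ \text{ for } j=1,\dots,k+1.$$ -/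

import Mathlib

open Filter Topology Asymptotics

noncomputable section

namespace JordanNewton

variable {𝕜 : Type*} [RCLike 𝕜]
  {B : Type*} [NormedAddCommGroup B] [NormedSpace 𝕜 B]
  {B' : Type*} [NormedAddCommGroup B'] [NormedSpace 𝕜 B']

/-- The family `L(ε) = G'[z(ε)]` of linearizations of `G` along the curve `z`. -/
def linFamily (G : B → B') (z : 𝕜 → B) (ε : 𝕜) : B →L[𝕜] B' := fderiv 𝕜 G (z ε)

/-- The polynomial curve `b₀ + ε b₁ + ⋯ + ε^i b_i`. -/
def polyCurve (b : ℕ → B) (i : ℕ) (ε : 𝕜) : B := ∑ j ∈ Finset.range (i + 1), ε ^ j • b j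

lemma polyCurve_add (b c : ℕ → B) (i : ℕ) (ε : 𝕜) :
    polyCurve (b + c) i ε = polyCurve b i ε + polyCurve c i ε := by
  simp [polyCurve, Finset.sum_add_distrib]

lemma polyCurve_smul (a : 𝕜) (b : ℕ → B) (i : ℕ) (ε : 𝕜) :
    polyCurve (a • b) i ε = a • polyCurve b i ε := by
  simp [polyCurve, Finset.smul_sum, smul_comm a]

lemma polyCurve_zero (i : ℕ) (ε : 𝕜) : polyCurve (0 : ℕ → B) i ε = 0 := by
  simp [polyCurve]

/-- `L` is `k`-surjective: every `y` is the leading coefficient of order `k` of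
`L(ε) b(ε)` for some curve `b(ε) = b₀ + ⋯ + ε^k b_k`, that is
`L(ε) b(ε) = ε^k y + O(ε^(k+1))`. -/
def KSurjective (L : 𝕜 → B →L[𝕜] B') (k : ℕ) : Prop :=
  ∀ y : B', ∃ b : ℕ → B,
    (fun ε : 𝕜 => L ε (polyCurve b k ε) - ε ^ k • y) =O[𝓝 0] fun ε : 𝕜 => ε ^ (k + 1)

/-- The elements `b₀` of rank at least `i`: those which are the root of a curve
`b(ε) = b₀ + ε b₁ + ⋯` with `L(ε) b(ε) = O(ε^i)`. -/
def rootSpace (L : 𝕜 → B →L[𝕜] B') (i : ℕ) : Submodule 𝕜 B where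
  carrier := {x | ∃ b : ℕ → B, b 0 = x ∧
    (fun ε : 𝕜 => L ε (polyCurve b i ε)) =O[𝓝 0] fun ε : 𝕜 => ε ^ i}
  add_mem' := by
    rintro x y ⟨b, hb, hb'⟩ ⟨c, hc, hc'⟩
    refine ⟨b + c, by simp [hb, hc], ?_⟩
    simpa [polyCurve_add] using hb'.add hc'
  zero_mem' := ⟨0, rfl, by simpa [polyCurve_zero] using isBigO_zero _ _⟩
  smul_mem' := by
    rintro a x ⟨b, hb, hb'⟩
    refine ⟨a • b, by simp [hb], ?_⟩
    refine (hb'.const_smul_left a).congr_left fun ε => ?_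
    simp [polyCurve_smul]

/-- The leading coefficients of order `i`: all `y` such that
`L(ε) b(ε) = ε^i y + O(ε^(i+1))` for some curve `b(ε) = b₀ + ⋯ + ε^i b_i`. -/
def leadSpace (L : 𝕜 → B →L[𝕜] B') (i : ℕ) : Submodule 𝕜 B' where
  carrier := {y | ∃ b : ℕ → B,
    (fun ε : 𝕜 => L ε (polyCurve b i ε) - ε ^ i • y) =O[𝓝 0] fun ε : 𝕜 => ε ^ (i + 1)}
  add_mem' := by
    rintro x y ⟨b, hb⟩ ⟨c, hc⟩
    refine ⟨b + c, ?_⟩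
    refine (hb.add hc).congr_left fun ε => ?_
    simp only [polyCurve_add, map_add, smul_add]
    abel
  zero_mem' := ⟨0, by simpa [polyCurve_zero] using isBigO_zero _ _⟩
  smul_mem' := by
    rintro a x ⟨b, hb⟩
    refine ⟨a • b, ?_⟩
    refine (hb.const_smul_left a).congr_left fun ε => ?_
    simp only [polyCurve_smul, map_smul, smul_sub, smul_comm a, Pi.smul_apply]

/-- The direct sums `B = N₁ᶜ ⊕ ⋯ ⊕ N_{k+1}ᶜ ⊕ N_{k+1}` and `B' = R₁ ⊕ ⋯ ⊕ R_{k+1}` built up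
from Jordan chains of increasing rank, with all subspaces closed. Indices start at `0`:
`N j` is `N_{j+1}ᶜ` for `j ≤ k`, `N (k+1)` is `N_{k+1}`, and `R j` is `R_{j+1}`.
The summands from `N_{i+1}ᶜ` on span the elements of rank at least `i`, and
`R₁ ⊕ ⋯ ⊕ R_{i+1}` is the space of leading coefficients of order `i`. -/
structure JordanScheme (L : 𝕜 → B →L[𝕜] B') (k : ℕ) where
  N : Fin (k + 2) → Submodule 𝕜 B
  R : Fin (k + 1) → Submodule 𝕜 B'
  isClosed_N : ∀ j, IsClosed (N j : Set B)
  isClosed_R : ∀ j, IsClosed (R j : Set B')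
  indep_N : iSupIndep N
  indep_R : iSupIndep R
  iSup_N : ∀ i : Fin (k + 2), ⨆ j ≥ i, N j = rootSpace L i
  iSup_R : ∀ i : Fin (k + 1), ⨆ j ≤ i, R j = leadSpace L i

namespace JordanScheme

variable {L : 𝕜 → B →L[𝕜] B'} {k : ℕ}

/-- `Nc j` is `N_{j+1}ᶜ`, `j = 0, …, k`. -/
abbrev Nc (T : JordanScheme L k) (j : Fin (k + 1)) : Submodule 𝕜 B := T.N j.castSucc

/-- The remaining summand `N_{k+1}` of `B`. -/
abbrev Nlast (T : JordanScheme L k) : Submodule 𝕜 B := T.N (Fin.last (k + 1))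

/-- The last summand `R_{k+1}` of `B'`. -/
abbrev Rlast (T : JordanScheme L k) : Submodule 𝕜 B' := T.R (Fin.last k)

lemma isCompl_Rlast (T : JordanScheme L k) (h : KSurjective L k) :
    IsCompl T.Rlast (⨆ j ≠ Fin.last k, T.R j) := by
  refine ⟨T.indep_R (Fin.last k), ?_⟩
  rw [codisjoint_iff, eq_top_iff]
  have htop : (⊤ : Submodule 𝕜 B') ≤ leadSpace L k := fun y _ => h y
  have hR := T.iSup_R (Fin.last k)
  rw [Fin.val_last] at hR
  rw [← hR] at htop
  refine htop.trans (iSup₂_le fun j _ => ?_)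
  by_cases hj : j = Fin.last k
  · subst hj
    exact le_sup_left
  · exact le_sup_of_le_right (le_iSup₂ (f := fun j (_ : j ≠ Fin.last k) => T.R j) j hj)

/-- The projection `P_{k+1}` of `B'` to `R_{k+1}` along `R₁ ⊕ ⋯ ⊕ R_k`. -/
def projLast (T : JordanScheme L k) (h : KSurjective L k) : B' →ₗ[𝕜] T.Rlast :=
  Submodule.projectionOnto T.Rlast (⨆ j ≠ Fin.last k, T.R j) (T.isCompl_Rlast h)

/-- A polynomial family `p_k(ε) = I + ε φ₁ + ⋯ + ε^k φ_k` of bounded operators, with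
`φ_j` mapping to `N₁ᶜ ⊕ ⋯ ⊕ N_{k+1-j}ᶜ` for `j ≥ 1`, together with isomorphisms
`S_{i+1} : N_{i+1}ᶜ → R_{i+1}`, such that `L(ε) p_k(ε) n = ε^i S_{i+1} n + O(ε^(i+1))` for `n` in
`N_{i+1}ᶜ`, `i = 0, …, k`, and `L(ε) p_k(ε) n = O(ε^(k+1))` for `n` in `N_{k+1}`. -/
structure ChainFamily (T : JordanScheme L k) where
  φ : Fin (k + 1) → B →L[𝕜] B
  S : (i : Fin (k + 1)) → T.Nc i ≃L[𝕜] T.R i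
  φ_zero : φ 0 = ContinuousLinearMap.id 𝕜 B
  φ_range : ∀ j : Fin (k + 1), j ≠ 0 → ∀ x : B,
    φ j x ∈ ⨆ (i : Fin (k + 1)) (_ : (i : ℕ) + j < k + 1), T.Nc i
  chain : ∀ (i : Fin (k + 1)) (n : T.Nc i),
    (fun ε : 𝕜 => L ε (∑ j : Fin (k + 1), ε ^ (j : ℕ) • φ j (n : B)) - ε ^ (i : ℕ) • (S i n : B'))
      =O[𝓝 0] fun ε : 𝕜 => ε ^ ((i : ℕ) + 1)
  chain_last : ∀ n : T.Nlast,
    (fun ε : 𝕜 => L ε (∑ j : Fin (k + 1), ε ^ (j : ℕ) • φ j (n : B)))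
      =O[𝓝 0] fun ε : 𝕜 => ε ^ (k + 1)

namespace ChainFamily

variable {T : JordanScheme L k}

/-- The operator `p_k(ε) = φ₀ + ε φ₁ + ⋯ + ε^k φ_k`, `φ₀ = I`. -/
def p (Φ : T.ChainFamily) (ε : 𝕜) : B →L[𝕜] B := ∑ j : Fin (k + 1), ε ^ (j : ℕ) • Φ.φ j

/-- The point `z(ε) + ε^s p_k(ε) {ε^k n₁ᶜ + ⋯ + ε n_kᶜ + n_{k+1}ᶜ + n_{k+1}}` of the generalized
cone around the curve `z` whose Jordan chains start at `ε^s`. -/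
def conePoint (Φ : T.ChainFamily) (z : 𝕜 → B) (s : ℕ) (ε : 𝕜) (ν : (j : Fin (k + 1)) → T.Nc j)
    (n : T.Nlast) : B :=
  z ε + ε ^ s • Φ.p ε (∑ j : Fin (k + 1), ε ^ (k - (j : ℕ)) • (ν j : B) + (n : B))

end ChainFamily

end JordanScheme

end JordanNewton

end

/-! Write `s = k - i`, so `q = 2k - i = i + 2s`, and insert the cone point `z(ε) + ε^s p(ε) w`, `w =
ε^k n₁ᶜ + ⋯ + n_{k+1}ᶜ + n_{k+1}`, into `G`. Three contributions appear, all of order `ε^q`. The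
error `G[z(ε)]` is `ε^q b(ε)`. In the linear term `ε^s L(ε) p(ε) w` the weights in `w` bring every
Jordan chain to order `ε^k`, so it equals `ε^(s+k) S ν + O(ε^(q+1))`, where `S = S₁ ⊕ ⋯ ⊕ S_{k+1}`
is an isomorphism onto `B'` by `k`-surjectivity. The nonlinear rest is no smaller: `G''[v] =
O(‖v‖^i)` and `v = O(ε)` give order `ε^(i + 2s)`. But at `ε = 0` it sees only `n_{k+1}ᶜ + n_{k+1}`,
and on a ball of radius `ρ` its Lipschitz constant `κ` after division by `ε^q` is `O(ρ)`, with
bounds depending on `M` alone (`eventually_norm_remainder_sub_le`).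

Division by `ε^q` costs `q` derivatives (`exists_eq_pow_smul`, by Hadamard's lemma) and leaves a
`C^m` equation `S ν + H(ε, ν, n) = 0`, to be solved by contraction. Only the last component of `S⁻¹`
is bounded in terms of `M`, and only the last component of `S⁻¹ b(0)` is small. The remaining
components are therefore scaled by a small factor `θ` (`dilatedMap`), which suppresses their part of
`S⁻¹`. Undoing the scaling costs `θ⁻¹` only in directions where the Lipschitz constant of `H` tends
to `0` with `ε`. Hence `ρ` and `δ` depend on `M` and `i` only, while `η` absorbs everything else
(`exists_solution_of_hasSmallLipschitz`). A still smaller factor gives uniqueness among `ν` bounded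
by an arbitrary `C`.

The operators `φ_j`, `S_j` come from `exists_isChain`: chains of rank `j` are built recursively by
subtracting shifted shorter chains, which removes the components of the leading coefficient in `R₁ ⊕
⋯ ⊕ R_j`. -/

noncomputable section

namespace JordanNewton

/-! ### Smoothness of integrals depending on a parameter -/

section ParametricIntegral

open MeasureTheory Set

variable {𝕜 : Type*} [RCLike 𝕜] {P : Type*} [NormedAddCommGroup P] [NormedSpace 𝕜 P]
  {Y : Type*} [NormedAddCommGroup Y] [NormedSpace 𝕜 Y] [NormedSpace ℝ Y]

/-- A function jointly continuous on `K ×ˢ Ω` is locally bounded in the parameter, uniformly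
on the compact set `K`. -/
lemma exists_eventually_norm_le {Z : Type*} [SeminormedAddCommGroup Z] {K : Set ℝ}
    (hK : IsCompact K) {Ω : Set P} (hΩ : IsOpen Ω) {f : ℝ → P → Z}
    (hf : ContinuousOn (fun q : ℝ × P => f q.1 q.2) (K ×ˢ Ω)) {p : P} (hp : p ∈ Ω) :
    ∃ C : ℝ, ∀ᶠ p' in 𝓝 p, ∀ t ∈ K, ‖f t p'‖ ≤ C := by
  have h1 : ContinuousOn (fun t => f t p) K :=
    hf.comp (f := fun t => (t, p)) (by fun_prop) fun t ht => ⟨ht, hp⟩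
  obtain ⟨C, hC⟩ := hK.exists_bound_of_continuousOn h1
  refine ⟨C + 1, ?_⟩
  have key : ∀ t ∈ K, ∀ᶠ z : P × ℝ in 𝓝 (p, t), z.2 ∈ K → ‖f z.2 z.1‖ ≤ C + 1 := by
    intro t ht
    have h2 := (hf (t, p) ⟨ht, hp⟩).norm
    have h3 : ∀ᶠ q in 𝓝[K ×ˢ Ω] (t, p), ‖f q.1 q.2‖ < C + 1 :=
      h2.eventually (gt_mem_nhds (lt_of_le_of_lt (hC t ht) (by linarith)))
    rw [eventually_nhdsWithin_iff] at h3
    have h4 : Tendsto (fun z : P × ℝ => (z.2, z.1)) (𝓝 (p, t)) (𝓝 (t, p)) :=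
      (continuous_swap.tendsto (p, t))
    have h5 : ∀ᶠ z : P × ℝ in 𝓝 (p, t), z.1 ∈ Ω :=
      continuous_fst.continuousAt.eventually (hΩ.mem_nhds hp)
    filter_upwards [h4.eventually h3, h5] with z hz hz' hzK
    exact (hz ⟨hzK, hz'⟩).le
  filter_upwards [hK.eventually_forall_of_forall_eventually
    (P := fun p' t => t ∈ K → ‖f t p'‖ ≤ C + 1) key] with p' h t ht
  exact h t ht ht

/-- Termwise integration of a jointly continuous family of Taylor series. -/
lemma hasFTaylorSeriesUpToOn_integral [SMulCommClass 𝕜 ℝ Y] [CompleteSpace Y] {n : WithTop ℕ∞}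
    {K : Set ℝ} (hK : IsCompact K)
    {Ω : Set P} (hΩ : IsOpen Ω) {f : ℝ → P → Y} {T : ℝ → P → FormalMultilinearSeries 𝕜 P Y}
    (hT : ∀ t ∈ K, HasFTaylorSeriesUpToOn n (f t) (T t) Ω)
    (hc : ∀ j : ℕ, (j : WithTop ℕ∞) ≤ n →
      ContinuousOn (fun q : ℝ × P => T q.1 q.2 j) (K ×ˢ Ω)) :
    HasFTaylorSeriesUpToOn n (fun p => ∫ t in K, f t p)
      (fun p j => ∫ t in K, T t p j) Ω := by
  have hKm : MeasurableSet K := hK.measurableSet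
  have hslice : ∀ j : ℕ, (j : WithTop ℕ∞) ≤ n → ∀ p ∈ Ω,
      ContinuousOn (fun t => T t p j) K := fun j hj p hp =>
    (hc j hj).comp (f := fun t => (t, p)) (by fun_prop) fun t ht => ⟨ht, hp⟩
  have hmeas : ∀ j : ℕ, (j : WithTop ℕ∞) ≤ n → ∀ p ∈ Ω,
      AEStronglyMeasurable (fun t => T t p j) (volume.restrict K) := fun j hj p hp =>
    (hslice j hj p hp).aestronglyMeasurable_of_isCompact hK hKm
  have hint : ∀ j : ℕ, (j : WithTop ℕ∞) ≤ n → ∀ p ∈ Ω,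
      IntegrableOn (fun t => T t p j) K := fun j hj p hp =>
    (hslice j hj p hp).integrableOn_compact hK
  have hfin : ∀ C : ℝ, Integrable (fun _ : ℝ => C) (volume.restrict K) := fun C =>
    integrableOn_const hK.measure_lt_top.ne
  refine ⟨fun p hp => ?_, fun j hj p hp => ?_, fun j hj p hp => ?_⟩
  · have h0 := (continuousMultilinearCurryFin0 𝕜 P Y).toContinuousLinearEquiv.integral_comp_comm
      (μ := volume.restrict K) (fun t => T t p 0)
    refine h0.symm.trans ?_
    exact setIntegral_congr_fun hKm fun t ht => (hT t ht).zero_eq p hp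
  · have hj1 : ((j + 1 : ℕ) : WithTop ℕ∞) ≤ n := by
      have := ENat.add_one_natCast_le_withTop_of_lt hj
      exact_mod_cast this
    have hcurry := ContinuousLinearEquiv.integral_comp_comm (𝕜 := 𝕜) (μ := volume.restrict K)
      (E := P [×(j + 1)]→L[𝕜] Y) (F := P →L[𝕜] P [×j]→L[𝕜] Y)
      (continuousMultilinearCurryLeftEquiv 𝕜 (fun _ : Fin (j + 1) => P)
        Y).toContinuousLinearEquiv (fun t => T t p (j + 1))
    -- Compactness of `K` gives one constant near `p` that serves as the integrable dominating
    -- function.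
    obtain ⟨C, hC⟩ := exists_eventually_norm_le hK hΩ (f := fun t p => T t p (j + 1)) (hc (j + 1) hj1) hp
    have hs : {p' | (∀ t ∈ K, ‖T t p' (j + 1)‖ ≤ C) ∧ p' ∈ Ω} ∈ 𝓝 p :=
      hC.and (hΩ.mem_nhds hp)
    have main := hasFDerivAt_integral_of_dominated_of_fderiv_le (𝕜 := 𝕜)
      (μ := volume.restrict K) (F := fun p t => T t p j)
      (F' := fun p t => (T t p (j + 1)).curryLeft) (bound := fun _ => C) (x₀ := p) hs
      (by filter_upwards [hΩ.mem_nhds hp] with p' hp' using hmeas j hj.le p' hp')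
      (hint j hj.le p hp)
      ((continuousMultilinearCurryLeftEquiv 𝕜 (fun _ : Fin (j + 1) => P)
        Y).continuous.comp_aestronglyMeasurable (hmeas (j + 1) hj1 p hp))
      (by
        filter_upwards [ae_restrict_mem hKm] with t ht p' hp'
        rw [ContinuousMultilinearMap.curryLeft_norm]
        exact hp'.1 t ht)
      (hfin C)
      (by
        filter_upwards [ae_restrict_mem hKm] with t ht p' hp'
        exact ((hT t ht).fderivWithin j hj p' hp'.2).hasFDerivAt (hΩ.mem_nhds hp'.2))
    have h2 : (∫ t in K, (T t p (j + 1)).curryLeft)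
        = (∫ t in K, T t p (j + 1)).curryLeft := hcurry
    rw [h2] at main
    exact main.hasFDerivWithinAt
  · obtain ⟨C, hC⟩ := exists_eventually_norm_le hK hΩ (f := fun t p => T t p j) (hc j hj) hp
    refine (continuousAt_of_dominated (bound := fun _ => C) ?_ ?_ (hfin C) ?_).continuousWithinAt
    · filter_upwards [hΩ.mem_nhds hp] with p' hp' using hmeas j hj p' hp'
    · filter_upwards [hC] with p' hp'
      filter_upwards [ae_restrict_mem hKm] with t ht using hp' t ht
    · filter_upwards [ae_restrict_mem hKm] with t ht
      exact ((hT t ht).cont j hj).continuousAt (hΩ.mem_nhds hp)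

/-- The scaling `(ε, x) ↦ (t ε, x)` of the first variable. -/
def scaleFst (𝕜 : Type*) [RCLike 𝕜] (E : Type*) [NormedAddCommGroup E] [NormedSpace 𝕜 E] (t : ℝ) :
    𝕜 × E →L[𝕜] 𝕜 × E :=
  (t : 𝕜) • (ContinuousLinearMap.inl 𝕜 𝕜 E).comp (ContinuousLinearMap.fst 𝕜 𝕜 E) +
    (ContinuousLinearMap.inr 𝕜 𝕜 E).comp (ContinuousLinearMap.snd 𝕜 𝕜 E)

variable {E : Type*} [NormedAddCommGroup E] [NormedSpace 𝕜 E]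

@[simp] lemma scaleFst_apply (t : ℝ) (q : 𝕜 × E) : scaleFst 𝕜 E t q = ((t : 𝕜) * q.1, q.2) := by
  simp [scaleFst]

lemma continuous_scaleFst : Continuous (scaleFst 𝕜 E) := by
  unfold scaleFst
  have : Continuous (fun t : ℝ => (t : 𝕜)) := RCLike.continuous_ofReal
  fun_prop

lemma scaleFst_mem {r : ℝ} {t : ℝ} (ht : t ∈ Icc (0 : ℝ) 1) {q : 𝕜 × E}
    (hq : q ∈ Metric.ball (0 : 𝕜) r ×ˢ (univ : Set E)) :
    scaleFst 𝕜 E t q ∈ Metric.ball (0 : 𝕜) r ×ˢ (univ : Set E) := by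
  simp only [mem_prod, mem_ball_zero_iff, mem_univ, and_true, scaleFst_apply, norm_mul,
    RCLike.norm_ofReal, abs_of_nonneg ht.1] at hq ⊢
  exact lt_of_le_of_lt (mul_le_of_le_one_left (norm_nonneg _) ht.2) hq

/-- The domain is star-shaped in `ε`, so each scaling with `t ∈ [0, 1]` maps it to itself. The
Taylor series of `u`, pulled back by these scalings, is jointly continuous in `t` and the point and
can be integrated termwise. -/
lemma contDiffOn_integral_scaleFst [SMulCommClass 𝕜 ℝ Y] [CompleteSpace Y] {n : ℕ∞} {r : ℝ}
    {u : 𝕜 × E → Y} (hu : ContDiffOn 𝕜 n u (Metric.ball (0 : 𝕜) r ×ˢ univ)) :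
    ContDiffOn 𝕜 n (fun q => ∫ t in Icc (0 : ℝ) 1, u (scaleFst 𝕜 E t q))
      (Metric.ball (0 : 𝕜) r ×ˢ univ) := by
  set Ω : Set (𝕜 × E) := Metric.ball (0 : 𝕜) r ×ˢ univ
  have hΩ : IsOpen Ω := Metric.isOpen_ball.prod isOpen_univ
  have hts := hu.ftaylorSeriesWithin hΩ.uniqueDiffOn
  refine (hasFTaylorSeriesUpToOn_integral (K := Icc (0 : ℝ) 1) isCompact_Icc hΩ
    (f := fun t q => u (scaleFst 𝕜 E t q)) (T := fun t q j =>
      (ftaylorSeriesWithin 𝕜 u Ω (scaleFst 𝕜 E t q) j).compContinuousLinearMap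
        fun _ => scaleFst 𝕜 E t) (fun t ht => ?_) fun j hj => ?_).contDiffOn
  · exact (hts.compContinuousLinearMap (scaleFst 𝕜 E t)).mono fun q hq => scaleFst_mem ht hq
  · have h1 : ContinuousOn (fun q : ℝ × (𝕜 × E) =>
        ftaylorSeriesWithin 𝕜 u Ω (scaleFst 𝕜 E q.1 q.2) j) (Icc 0 1 ×ˢ Ω) := by
      refine (hts.cont j hj).comp (f := fun q : ℝ × (𝕜 × E) => scaleFst 𝕜 E q.1 q.2) ?_ ?_
      · exact ((continuous_scaleFst.comp continuous_fst).clm_apply continuous_snd).continuousOn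
      · exact fun q hq => scaleFst_mem hq.1 hq.2
    have h2 : Continuous fun q : ℝ × (𝕜 × E) =>
        ContinuousMultilinearMap.compContinuousLinearMapContinuousMultilinear 𝕜
          (fun _ : Fin j => 𝕜 × E) (fun _ : Fin j => 𝕜 × E) Y (fun _ => scaleFst 𝕜 E q.1) :=
      (ContinuousMultilinearMap.cont _).comp
        (continuous_pi fun _ => continuous_scaleFst.comp continuous_fst)
    exact h2.continuousOn.clm_apply h1

end ParametricIntegral

/-! ### Hadamard's lemma and Taylor expansion in the first variable -/

section Hadamard

open Set

variable {𝕜 : Type*} [RCLike 𝕜] {E : Type*} [NormedAddCommGroup E] [NormedSpace 𝕜 E]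
  {Y : Type*} [NormedAddCommGroup Y] [NormedSpace 𝕜 Y] [CompleteSpace Y]

/-- Hadamard's lemma with a parameter. -/
lemma exists_eq_add_smul {n : ℕ∞} {r : ℝ} {g : 𝕜 × E → Y}
    (hg : ContDiffOn 𝕜 ((n + 1 : ℕ∞) : WithTop ℕ∞) g (Metric.ball (0 : 𝕜) r ×ˢ univ)) :
    ∃ h : 𝕜 × E → Y, ContDiffOn 𝕜 n h (Metric.ball (0 : 𝕜) r ×ˢ univ) ∧
      ∀ ε ∈ Metric.ball (0 : 𝕜) r, ∀ x, g (ε, x) = g (0, x) + ε • h (ε, x) := by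
  let : NormedSpace ℝ Y := NormedSpace.restrictScalars ℝ 𝕜 Y
  have : IsScalarTower ℝ 𝕜 Y := RestrictScalars.isScalarTower ℝ 𝕜 Y
  have : SMulCommClass 𝕜 ℝ Y := IsScalarTower.to_smulCommClass'
  set Ω : Set (𝕜 × E) := Metric.ball (0 : 𝕜) r ×ˢ univ
  have hΩ : IsOpen Ω := Metric.isOpen_ball.prod isOpen_univ
  -- The quotient is `∫₀¹ ∂_ε g(tε, x) dt`; the partial derivative accounts for the one lost degree
  -- of smoothness.
  have hu : ContDiffOn 𝕜 n (fun q => fderiv 𝕜 g q (1, 0)) Ω :=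
    (hg.fderiv_of_isOpen hΩ (by push_cast; exact le_rfl)).clm_apply contDiffOn_const
  refine ⟨_, contDiffOn_integral_scaleFst hu, fun ε hε x => ?_⟩
  have hmem : ∀ t ∈ Icc (0 : ℝ) 1, scaleFst 𝕜 E t (ε, x) ∈ Ω := fun t ht =>
    scaleFst_mem ht ⟨hε, mem_univ _⟩
  have hder : ∀ t ∈ uIcc (0 : ℝ) 1, HasDerivAt (fun t : ℝ => g ((t : 𝕜) * ε, x))
      (ε • fderiv 𝕜 g (scaleFst 𝕜 E t (ε, x)) (1, 0)) t := by
    intro t ht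
    rw [uIcc_of_le zero_le_one] at ht
    have h1 : HasFDerivAt g (fderiv 𝕜 g (scaleFst 𝕜 E t (ε, x))) (scaleFst 𝕜 E t (ε, x)) :=
      ((hg.differentiableOn (by simp)).differentiableAt
        (hΩ.mem_nhds (hmem t ht))).hasFDerivAt
    have h2 : HasDerivAt (fun t : 𝕜 => (t * ε, x)) (ε, (0 : E)) (t : 𝕜) := by
      have := ((hasDerivAt_id (t : 𝕜)).mul_const ε).prodMk (hasDerivAt_const (t : 𝕜) x)
      simpa using this
    rw [scaleFst_apply] at h1
    have h3 := (h1.comp_hasDerivAt (t : 𝕜) h2).scomp t (RCLike.ofRealCLM (K := 𝕜)).hasDerivAt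
    have h4 : ((ε, 0) : 𝕜 × E) = ε • (1, 0) := by simp
    rw [h4, map_smul] at h3
    simpa [Function.comp_def] using h3
  have hcont : ContinuousOn (fun t : ℝ => fderiv 𝕜 g (scaleFst 𝕜 E t (ε, x)) (1, 0)) (Icc 0 1) :=
    hu.continuousOn.comp (f := fun t : ℝ => scaleFst 𝕜 E t (ε, x))
      (continuous_scaleFst.clm_apply continuous_const).continuousOn hmem
  have hftc := intervalIntegral.integral_eq_sub_of_hasDerivAt hder
    (ContinuousOn.intervalIntegrable (by
      rw [uIcc_of_le zero_le_one]; exact hcont.const_smul ε))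
  rw [intervalIntegral.integral_smul, intervalIntegral.integral_of_le zero_le_one,
    ← MeasureTheory.integral_Icc_eq_integral_Ioc] at hftc
  simp only [RCLike.ofReal_one, one_mul, RCLike.ofReal_zero, zero_mul] at hftc
  rw [hftc]; abel

/-- Taylor expansion in the first variable with a smooth remainder. -/
lemma exists_taylor_expansion {n : ℕ∞} (N : ℕ) {r : ℝ} {g : 𝕜 × E → Y}
    (hg : ContDiffOn 𝕜 ((n + N : ℕ∞) : WithTop ℕ∞) g (Metric.ball (0 : 𝕜) r ×ˢ univ)) :
    ∃ (c : ℕ → E → Y) (h : 𝕜 × E → Y), ContDiffOn 𝕜 n h (Metric.ball (0 : 𝕜) r ×ˢ univ) ∧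
      ∀ ε ∈ Metric.ball (0 : 𝕜) r, ∀ x,
        g (ε, x) = ∑ j ∈ Finset.range N, ε ^ j • c j x + ε ^ N • h (ε, x) := by
  induction N generalizing g with
  | zero => exact ⟨0, g, by simpa using hg, by simp⟩
  | succ N ih =>
    have hg' : ContDiffOn 𝕜 (((n + N : ℕ∞) + 1 : ℕ∞) : WithTop ℕ∞) g
        (Metric.ball (0 : 𝕜) r ×ˢ univ) := by
      convert hg using 2
      push_cast; rw [add_assoc]
    obtain ⟨h, hh, hgh⟩ := exists_eq_add_smul hg'
    obtain ⟨c, R, hR, hc⟩ := ih hh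
    refine ⟨fun j x => Nat.casesOn j (g (0, x)) fun j => c j x, R, hR, fun ε hε x => ?_⟩
    rw [hgh ε hε x, hc ε hε x, Finset.sum_range_succ']
    simp [smul_add, Finset.smul_sum, smul_smul, pow_succ', add_comm, add_left_comm]

end Hadamard

/-! ### Power series coefficients in place of `O`-estimates -/

section Expansion

variable {𝕜 : Type*} [RCLike 𝕜]
  {E : Type*} [NormedAddCommGroup E] [NormedSpace 𝕜 E]
  {F : Type*} [NormedAddCommGroup F] [NormedSpace 𝕜 F]

lemma isBigO_pow_pow_of_le {m n : ℕ} (h : m ≤ n) :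
    (fun ε : 𝕜 => ε ^ n) =O[𝓝 0] fun ε : 𝕜 => ε ^ m := by
  obtain ⟨d, rfl⟩ := Nat.exists_eq_add_of_le h
  have h1 : (fun ε : 𝕜 => ε ^ d) =O[𝓝 0] fun _ => (1 : 𝕜) :=
    ((continuous_pow d).tendsto (0 : 𝕜)).isBigO_one 𝕜
  simpa [pow_add] using (isBigO_refl (fun ε : 𝕜 => ε ^ m) (𝓝 0)).mul h1

lemma isBigO_pow_smul {f : 𝕜 → E} {m : ℕ} (n : ℕ) (hf : f =O[𝓝 0] fun ε : 𝕜 => ε ^ m) :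
    (fun ε => ε ^ n • f ε) =O[𝓝 0] fun ε : 𝕜 => ε ^ (n + m) := by
  simpa [pow_add] using (isBigO_refl (fun ε : 𝕜 => ε ^ n) (𝓝 0)).smul hf

lemma isBigO_pow_smul_of_one {f : 𝕜 → E} (n : ℕ) (hf : f =O[𝓝 0] fun _ => (1 : 𝕜)) :
    (fun ε => ε ^ n • f ε) =O[𝓝 0] fun ε : 𝕜 => ε ^ n :=
  isBigO_pow_smul (m := 0) n (hf.congr_right fun ε => (pow_zero ε).symm)

lemma isBigO_pow_smul_const (n : ℕ) (c : E) :
    (fun ε : 𝕜 => ε ^ n • c) =O[𝓝 0] fun ε : 𝕜 => ε ^ n :=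
  isBigO_pow_smul_of_one n (isBigO_const_const c (one_ne_zero (α := 𝕜)) (𝓝 0))

lemma polyCurve_succ (b : ℕ → E) (i : ℕ) (ε : 𝕜) :
    polyCurve b (i + 1) ε = polyCurve b i ε + ε ^ (i + 1) • b (i + 1) := by
  simp only [polyCurve]; rw [Finset.sum_range_succ]

lemma polyCurve_succ' (b : ℕ → E) (i : ℕ) (ε : 𝕜) :
    polyCurve b (i + 1) ε = b 0 + ε • polyCurve (fun j => b (j + 1)) i ε := by
  simp only [polyCurve]
  rw [Finset.sum_range_succ']
  simp [Finset.smul_sum, smul_smul, pow_succ', add_comm]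

lemma polyCurve_sub (b c : ℕ → E) (i : ℕ) (ε : 𝕜) :
    polyCurve (b - c) i ε = polyCurve b i ε - polyCurve c i ε := by
  simp [polyCurve, Finset.sum_sub_distrib, smul_sub]

lemma polyCurve_congr {b c : ℕ → E} {i : ℕ} (h : ∀ j ≤ i, b j = c j) (ε : 𝕜) :
    polyCurve b i ε = polyCurve c i ε := by
  refine Finset.sum_congr rfl fun j hj => ?_
  rw [h j (by simpa [Nat.lt_succ_iff] using hj)]

lemma polyCurve_eq_zero {c : ℕ → E} {i : ℕ} (h : ∀ j ≤ i, c j = 0) (ε : 𝕜) :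
    polyCurve c i ε = 0 := by
  rw [polyCurve_congr (c := 0) h, polyCurve_zero]

lemma polyCurve_single (y : E) (i : ℕ) (ε : 𝕜) :
    polyCurve (Pi.single i y) i ε = ε ^ i • y := by
  rw [polyCurve, Finset.sum_eq_single i]
  · simp
  · intro j _ hj
    simp [Pi.single_eq_of_ne hj]
  · simp

lemma continuous_polyCurve (b : ℕ → E) (i : ℕ) : Continuous (polyCurve (𝕜 := 𝕜) b i) := by
  unfold polyCurve; fun_prop

lemma polyCurve_tail_isBigO (c : ℕ → E) {i k : ℕ} (h : i ≤ k) :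
    (fun ε : 𝕜 => polyCurve c k ε - polyCurve c i ε) =O[𝓝 0] fun ε : 𝕜 => ε ^ (i + 1) := by
  induction k, h using Nat.le_induction with
  | base => simpa using isBigO_zero _ _
  | succ k hk ih =>
    have h2 := (isBigO_pow_smul_const (𝕜 := 𝕜) (k + 1) (c (k + 1))).trans
      (isBigO_pow_pow_of_le (m := i + 1) (by omega))
    refine (ih.add h2).congr_left fun ε => ?_
    rw [polyCurve_succ]; abel

/-- A polynomial of degree at most `n` which is `O(ε^(n+1))` vanishes. -/
lemma eq_zero_of_polyCurve_isBigO {n : ℕ} {c : ℕ → E}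
    (h : polyCurve c n =O[𝓝[≠] 0] fun ε : 𝕜 => ε ^ (n + 1)) : ∀ t ≤ n, c t = 0 := by
  induction n generalizing c with
  | zero =>
    intro t ht
    obtain rfl : t = 0 := by omega
    have h1 : Tendsto (polyCurve (𝕜 := 𝕜) c 0) (𝓝[≠] 0) (𝓝 0) := by
      refine h.trans_tendsto ?_
      have : Tendsto (fun ε : 𝕜 => ε ^ (0 + 1)) (𝓝 0) (𝓝 0) := by
        simpa using (continuous_pow (0 + 1)).tendsto (0 : 𝕜)
      exact this.mono_left nhdsWithin_le_nhds
    have h2 : polyCurve (𝕜 := 𝕜) c 0 = fun _ => c 0 := by ext; simp [polyCurve]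
    rw [h2] at h1
    exact tendsto_nhds_unique tendsto_const_nhds h1
  | succ n ih =>
    have h0 : c 0 = 0 := by
      have h1 : Tendsto (polyCurve (𝕜 := 𝕜) c (n + 1)) (𝓝[≠] 0) (𝓝 0) := by
        refine h.trans_tendsto ?_
        have : Tendsto (fun ε : 𝕜 => ε ^ (n + 1 + 1)) (𝓝 0) (𝓝 0) := by
          simpa using (continuous_pow (n + 1 + 1)).tendsto (0 : 𝕜)
        exact this.mono_left nhdsWithin_le_nhds
      have h2 : Tendsto (polyCurve (𝕜 := 𝕜) c (n + 1)) (𝓝[≠] 0) (𝓝 (c 0)) := by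
        have := ((continuous_polyCurve (𝕜 := 𝕜) c (n + 1)).tendsto 0).mono_left
          (nhdsWithin_le_nhds (s := {0}ᶜ))
        rw [polyCurve_succ'] at this
        simpa using this
      exact tendsto_nhds_unique h2 h1
    have h3 : polyCurve (fun j => c (j + 1)) n =O[𝓝[≠] 0] fun ε : 𝕜 => ε ^ (n + 1) := by
      have h4 := (isBigO_refl (fun ε : 𝕜 => ε⁻¹) (𝓝[≠] 0)).smul h
      refine h4.congr' ?_ ?_
      · filter_upwards [self_mem_nhdsWithin] with ε hε
        rw [polyCurve_succ', h0, zero_add, smul_smul, inv_mul_cancel₀ hε, one_smul]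
      · filter_upwards [self_mem_nhdsWithin] with ε hε
        rw [smul_eq_mul, pow_succ' ε (n + 1), ← mul_assoc, inv_mul_cancel₀ hε, one_mul]
    intro t ht
    cases t with
    | zero => exact h0
    | succ t => exact ih h3 t (by omega)

/-- The coefficient of order `t` of the product of the series `∑ ε^l a_l` and `∑ ε^l b_l`. -/
def coef (a : ℕ → E →L[𝕜] F) (b : ℕ → E) (t : ℕ) : F :=
  ∑ x ∈ Finset.HasAntidiagonal.antidiagonal t, a x.1 (b x.2)

variable (a : ℕ → E →L[𝕜] F)

lemma coef_zero_index (b : ℕ → E) : coef a b 0 = a 0 (b 0) := by simp [coef]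

lemma coef_succ (b : ℕ → E) (t : ℕ) :
    coef a b (t + 1) = a (t + 1) (b 0) + coef a (fun j => b (j + 1)) t := by
  simp [coef, Finset.Nat.sum_antidiagonal_succ']

lemma coef_sub (b c : ℕ → E) (t : ℕ) : coef a (b - c) t = coef a b t - coef a c t := by
  simp [coef, Finset.sum_sub_distrib]

lemma coef_sum {ι : Type*} (s : Finset ι) (b : ι → ℕ → E) (t : ℕ) :
    coef a (fun l => ∑ i ∈ s, b i l) t = ∑ i ∈ s, coef a (b i) t := by
  simp only [coef, map_sum]
  exact Finset.sum_comm

/-- The curve `ε^d b(ε)`. -/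
def shiftCurve (d : ℕ) (b : ℕ → E) (l : ℕ) : E := if d ≤ l then b (l - d) else 0

lemma coef_shiftCurve (d : ℕ) (b : ℕ → E) (t : ℕ) :
    coef a (shiftCurve d b) t = if d ≤ t then coef a b (t - d) else 0 := by
  induction d generalizing t with
  | zero => simp [show shiftCurve 0 b = b by ext; simp [shiftCurve]]
  | succ d ih =>
    cases t with
    | zero => simp [coef_zero_index, shiftCurve]
    | succ t =>
      rw [coef_succ]
      have : (fun j => shiftCurve (d + 1) b (j + 1)) = shiftCurve d b := by
        ext j; simp [shiftCurve]
      rw [this, ih]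
      simp [shiftCurve]

/-- `L(ε)` agrees with `∑ ε^t a_t` up to the order `k`. -/
def HasExpansion (L : 𝕜 → E →L[𝕜] F) (a : ℕ → E →L[𝕜] F) (k : ℕ) : Prop :=
  ∀ i ≤ k, (fun ε => L ε - polyCurve a i ε) =O[𝓝 0] fun ε : 𝕜 => ε ^ (i + 1)

variable {a} {L : 𝕜 → E →L[𝕜] F} {k : ℕ}

lemma HasExpansion.isBigO_one (h : HasExpansion L a k) : L =O[𝓝 0] fun _ => (1 : 𝕜) := by
  have h0 := (h 0 (Nat.zero_le _)).trans (isBigO_pow_pow_of_le (m := 0) (by omega))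
  have h1 : (fun ε : 𝕜 => polyCurve a 0 ε) =O[𝓝 0] fun _ => (1 : 𝕜) :=
    ((continuous_polyCurve a 0).tendsto 0).isBigO_one 𝕜
  simp only [pow_zero] at h0
  exact (h0.add h1).congr_left fun ε => by simp

lemma HasExpansion.of_remainder {R : 𝕜 → E →L[𝕜] F} (hR : R =O[𝓝 0] fun _ => (1 : 𝕜))
    (h : ∀ᶠ ε in 𝓝 0, L ε = polyCurve a k ε + ε ^ (k + 1) • R ε) : HasExpansion L a k := by
  intro i hi
  have h1 : (fun ε : 𝕜 => ε ^ (k + 1) • R ε) =O[𝓝 0] fun ε : 𝕜 => ε ^ (i + 1) :=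
    (isBigO_pow_smul_of_one (k + 1) hR).trans (isBigO_pow_pow_of_le (by omega))
  refine ((polyCurve_tail_isBigO a hi).add h1).congr' ?_ EventuallyEq.rfl
  filter_upwards [h] with ε hε
  rw [hε]; abel

lemma isBigO_clm_apply_const {f : 𝕜 → E →L[𝕜] F} {g : 𝕜 → 𝕜} (hf : f =O[𝓝 0] g) (x : E) :
    (fun ε => f ε x) =O[𝓝 0] g := by
  refine IsBigO.trans ?_ hf
  refine IsBigO.of_bound ‖x‖ (Eventually.of_forall fun ε => ?_)
  rw [mul_comm]; exact (f ε).le_opNorm x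

/-- Induction on the order by peeling off the root: `b(ε) = b₀ + ε c(ε)`, where the factor `ε`
lowers by one the order needed for `c`. -/
lemma HasExpansion.apply_isBigO (h : HasExpansion L a k) {i : ℕ} (hi : i ≤ k) (b : ℕ → E) :
    (fun ε => L ε (polyCurve b i ε) - polyCurve (coef a b) i ε) =O[𝓝 0]
      fun ε : 𝕜 => ε ^ (i + 1) := by
  induction i generalizing b with
  | zero =>
    refine (isBigO_clm_apply_const (h 0 hi) (b 0)).congr_left fun ε => ?_
    simp [polyCurve, coef_zero_index]
  | succ i ih =>
    have h1 := isBigO_clm_apply_const (h (i + 1) hi) (b 0)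
    have h2 := isBigO_pow_smul 1 (ih (by omega) (fun j => b (j + 1)))
    rw [show 1 + (i + 1) = i + 1 + 1 by ring] at h2
    refine (h1.add h2).congr_left fun ε => ?_
    rw [polyCurve_succ' b, polyCurve_succ' a, polyCurve_succ' (coef a b)]
    have h3 : (fun j => coef a b (j + 1))
        = (fun j => a (j + 1) (b 0)) + coef a (fun j => b (j + 1)) := by
      ext j; exact coef_succ a b j
    have h4 : polyCurve (fun j => a (j + 1)) i ε (b 0)
        = polyCurve (fun j => a (j + 1) (b 0)) i ε := by
      simp [polyCurve]
    rw [h3, polyCurve_add, coef_zero_index]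
    simp only [pow_one, map_add, map_smul, sub_apply,
      add_apply, smul_apply, h4, smul_sub, smul_add]
    abel

lemma HasExpansion.coef_eq_of_isBigO (h : HasExpansion L a k) {i : ℕ} (hi : i ≤ k) {b : ℕ → E}
    {y : F} (hy : (fun ε : 𝕜 => L ε (polyCurve b i ε) - ε ^ i • y) =O[𝓝 0]
      fun ε : 𝕜 => ε ^ (i + 1)) : (∀ t < i, coef a b t = 0) ∧ coef a b i = y := by
  have h1 : polyCurve (coef a b - Pi.single i y) i =O[𝓝 0] fun ε : 𝕜 => ε ^ (i + 1) := by
    refine (hy.sub (h.apply_isBigO hi b)).congr_left fun ε => ?_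
    rw [polyCurve_sub, polyCurve_single]; abel
  have h2 := eq_zero_of_polyCurve_isBigO (h1.mono nhdsWithin_le_nhds)
  refine ⟨fun t ht => ?_, ?_⟩
  · simpa [Pi.single_eq_of_ne ht.ne] using h2 t ht.le
  · simpa [sub_eq_zero] using h2 i le_rfl

lemma HasExpansion.isBigO_of_coef (h : HasExpansion L a k) {i : ℕ} (hi : i ≤ k) {b : ℕ → E}
    {y : F} (h0 : ∀ t < i, coef a b t = 0) (hy : coef a b i = y) :
    (fun ε : 𝕜 => L ε (polyCurve b i ε) - ε ^ i • y) =O[𝓝 0] fun ε : 𝕜 => ε ^ (i + 1) := by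
  refine (h.apply_isBigO hi b).congr_left fun ε => ?_
  rw [← polyCurve_single, polyCurve_congr (b := coef a b)]
  intro j hj
  rcases hj.lt_or_eq with hj | rfl
  · rw [h0 j hj, Pi.single_eq_of_ne hj.ne]
  · rw [hy, Pi.single_eq_same]

lemma HasExpansion.mem_leadSpace_iff (h : HasExpansion L a k) {i : ℕ} (hi : i ≤ k) {y : F} :
    y ∈ leadSpace L i ↔ ∃ b : ℕ → E, (∀ t < i, coef a b t = 0) ∧ coef a b i = y :=
  ⟨fun ⟨b, hb⟩ => ⟨b, h.coef_eq_of_isBigO hi hb⟩,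
    fun ⟨b, h0, hy⟩ => ⟨b, h.isBigO_of_coef hi h0 hy⟩⟩

/-- Rank is governed by the coefficients of order below `i`; the last term `ε^i b_i` of the curve
contributes only `O(ε^i)`. This is why rank `k + 1` is still detected by an expansion up to order
`k`. -/
lemma HasExpansion.mem_rootSpace_iff (h : HasExpansion L a k) {i : ℕ} (hi : i ≤ k + 1) {x : E} :
    x ∈ rootSpace L i ↔ ∃ b : ℕ → E, b 0 = x ∧ ∀ t < i, coef a b t = 0 := by
  cases i with
  | zero =>
    simp only [not_lt_zero, IsEmpty.forall_iff, implies_true, and_true]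
    constructor
    · rintro ⟨b, hb, -⟩
      exact ⟨b, hb⟩
    · rintro ⟨b, hb⟩
      refine ⟨b, hb, ?_⟩
      refine (isBigO_clm_apply_const h.isBigO_one (b 0)).congr (fun ε => ?_) fun ε => ?_ <;>
        simp [polyCurve]
  | succ i =>
    have hlast : ∀ b : ℕ → E, (fun ε : 𝕜 => L ε (ε ^ (i + 1) • b (i + 1))) =O[𝓝 0]
        fun ε : 𝕜 => ε ^ (i + 1) := fun b => by
      simpa using isBigO_pow_smul_of_one (i + 1)
        (isBigO_clm_apply_const h.isBigO_one (b (i + 1)))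
    refine exists_congr fun b => and_congr_right fun _ => ⟨fun hb => ?_, fun hb => ?_⟩
    · have h1 : polyCurve (coef a b) i =O[𝓝 0] fun ε : 𝕜 => ε ^ (i + 1) := by
        refine ((hb.sub (hlast b)).sub (h.apply_isBigO (by omega) b)).congr_left fun ε => ?_
        rw [polyCurve_succ, map_add]; abel
      intro t ht
      exact eq_zero_of_polyCurve_isBigO (h1.mono nhdsWithin_le_nhds) t (by omega)
    · refine ((h.apply_isBigO (by omega) b).add (hlast b)).congr_left fun ε => ?_
      rw [polyCurve_succ b, map_add, polyCurve_eq_zero (c := coef a b) fun t ht => hb t (by omega)]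
      simp

end Expansion

/-! ### Topological direct sums of closed subspaces -/

section InternalSum

variable {𝕜 : Type*} [RCLike 𝕜] {E : Type*} [NormedAddCommGroup E] [NormedSpace 𝕜 E]
  [CompleteSpace E] {ι : Type*} [Fintype ι] {V : ι → Submodule 𝕜 E}

/-- The isomorphism from the product to the sum for a direct sum of closed subspaces. -/
def sumEquiv (hc : ∀ j, IsClosed (V j : Set E)) (hi : iSupIndep V) (ht : ⨆ j, V j = ⊤) :
    ((j : ι) → V j) ≃L[𝕜] E :=
  haveI : ∀ j, CompleteSpace (V j) := fun j => (hc j).completeSpace_coe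
  -- Closedness makes the product a Banach space, so the open mapping theorem yields a bounded
  -- inverse and hence bounded component projections.
  ContinuousLinearEquiv.ofBijective
    (∑ j, (V j).subtypeL ∘L ContinuousLinearMap.proj (R := 𝕜) (φ := fun j => V j) j)
    (by
      rw [LinearMap.ker_eq_bot']
      intro v hv
      have h := (iSupIndep_iff_finsetSum_eq_zero_imp_eq_zero V).1 hi Finset.univ
        (fun j => (v j : E)) (fun j _ => (v j).2)
        (by simpa [sum_apply] using hv)
      ext j
      simpa using h j (Finset.mem_univ j))
    (by
      classical
      rw [← top_le_iff, ← ht]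
      refine iSup_le fun j x hx => ⟨Pi.single j ⟨x, hx⟩, ?_⟩
      simp only [ContinuousLinearMap.coe_coe, sum_apply,
        ContinuousLinearMap.comp_apply, ContinuousLinearMap.proj_apply, Submodule.subtypeL_apply]
      rw [Finset.sum_eq_single j]
      · simp
      · intro i _ hij
        simp [Pi.single_eq_of_ne hij]
      · simp)

variable (hc : ∀ j, IsClosed (V j : Set E)) (hi : iSupIndep V) (ht : ⨆ j, V j = ⊤)

lemma sumEquiv_apply (v : (j : ι) → V j) : sumEquiv hc hi ht v = ∑ j, (v j : E) := by
  simp [sumEquiv]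

/-- The component in `V j` with respect to a direct sum of closed subspaces. -/
def sumProj (j : ι) : E →L[𝕜] V j :=
  ContinuousLinearMap.proj (R := 𝕜) (φ := fun j => V j) j ∘L
    ((sumEquiv hc hi ht).symm : E →L[𝕜] (j : ι) → V j)

lemma sum_sumProj (x : E) : ∑ j, (sumProj hc hi ht j x : E) = x := by
  have := (sumEquiv hc hi ht).apply_symm_apply x
  rwa [sumEquiv_apply] at this

lemma sumProj_sum (v : (j : ι) → V j) (j : ι) : sumProj hc hi ht j (∑ i, (v i : E)) = v j := by
  rw [← sumEquiv_apply hc hi ht]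
  simp [sumProj]

lemma sumProj_self {j : ι} (v : V j) : sumProj hc hi ht j (v : E) = v := by
  classical
  have := sumProj_sum hc hi ht (Pi.single j v) j
  rw [Finset.sum_eq_single j] at this
  · simpa using this
  · intro i _ hij
    simp [Pi.single_eq_of_ne hij]
  · simp

lemma sumProj_of_ne {i j : ι} (hij : i ≠ j) {x : E} (hx : x ∈ V j) :
    sumProj hc hi ht i x = 0 := by
  classical
  have := sumProj_sum hc hi ht (Pi.single j ⟨x, hx⟩) i
  rw [Finset.sum_eq_single j] at this
  · simpa [Pi.single_eq_of_ne hij] using this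
  · intro l _ hlj
    simp [Pi.single_eq_of_ne hlj]
  · simp

lemma sumProj_of_mem_biSup {p : ι → Prop} {i : ι} (hp : ¬ p i) {x : E}
    (hx : x ∈ ⨆ (j) (_ : p j), V j) : sumProj hc hi ht i x = 0 := by
  have : (⨆ (j) (_ : p j), V j) ≤ (sumProj hc hi ht i).ker := by
    refine iSup₂_le fun j hj y hy => ?_
    exact sumProj_of_ne hc hi ht (by rintro rfl; exact hp hj) hy
  exact this hx

end InternalSum

/-! ### Coefficients of products of operator series -/

section Operator

variable {𝕜 : Type*} [RCLike 𝕜]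
  {E : Type*} [NormedAddCommGroup E] [NormedSpace 𝕜 E]
  {F : Type*} [NormedAddCommGroup F] [NormedSpace 𝕜 F]
  {H : Type*} [NormedAddCommGroup H] [NormedSpace 𝕜 H]

/-- The coefficient of order `t` of the composition of `∑ ε^l a_l` and `∑ ε^l ψ_l`. -/
def coefOp (a : ℕ → E →L[𝕜] F) (ψ : ℕ → H →L[𝕜] E) (t : ℕ) : H →L[𝕜] F :=
  ∑ x ∈ Finset.HasAntidiagonal.antidiagonal t, a x.1 ∘L ψ x.2

lemma coefOp_apply (a : ℕ → E →L[𝕜] F) (ψ : ℕ → H →L[𝕜] E) (t : ℕ) (x : H) :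
    coefOp a ψ t x = coef a (fun l => ψ l x) t := by
  simp [coefOp, coef]

end Operator

variable {𝕜 : Type*} [RCLike 𝕜]
  {B : Type*} [NormedAddCommGroup B] [NormedSpace 𝕜 B]
  {B' : Type*} [NormedAddCommGroup B'] [NormedSpace 𝕜 B']
  {L : 𝕜 → B →L[𝕜] B'} {k : ℕ} {a : ℕ → B →L[𝕜] B'}

/-! ### Construction of Jordan chains and of the isomorphisms `S_j` -/

namespace JordanScheme

variable (T : JordanScheme L k)

lemma iSup_R_eq_top (hs : KSurjective L k) : ⨆ j, T.R j = ⊤ := by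
  rw [← top_le_iff]
  intro y _
  have h : y ∈ leadSpace L k := hs y
  have hR := T.iSup_R (Fin.last k)
  rw [Fin.val_last] at hR
  rw [← hR] at h
  exact (iSup₂_le fun j _ => le_iSup T.R j) h

lemma iSup_N_eq_top (ha : HasExpansion L a k) : ⨆ j, T.N j = ⊤ := by
  rw [← top_le_iff]
  intro x _
  have h : x ∈ rootSpace L ((0 : Fin (k + 2)) : ℕ) :=
    (ha.mem_rootSpace_iff (by simp)).2 ⟨fun _ => x, rfl, by simp⟩
  rw [← T.iSup_N 0] at h
  exact (iSup₂_le fun j _ => le_iSup T.N j) h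

lemma N_le_rootSpace (j : Fin (k + 2)) : T.N j ≤ rootSpace L j := by
  rw [← T.iSup_N j]
  exact le_iSup₂ (f := fun i (_ : i ≥ j) => T.N i) j le_rfl

lemma Nc_le_rootSpace (j : Fin (k + 1)) : T.Nc j ≤ rootSpace L j :=
  T.N_le_rootSpace j.castSucc

lemma R_le_leadSpace (j : Fin (k + 1)) : T.R j ≤ leadSpace L j := by
  rw [← T.iSup_R j]
  exact le_iSup₂ (f := fun i (_ : i ≤ j) => T.R i) j le_rfl

/-- The component in `R_{j+1}`. -/
def projR [CompleteSpace B'] (hs : KSurjective L k) (j : Fin (k + 1)) : B' →L[𝕜] T.R j :=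
  sumProj T.isClosed_R T.indep_R (T.iSup_R_eq_top hs) j

variable {T}

/-- Two curves with the same root whose images vanish up to order `j` have leading coefficients of
order `j` that differ by an element of `R₁ ⊕ ⋯ ⊕ R_j`. -/
lemma coef_sub_coef_mem (ha : HasExpansion L a k) (j : Fin (k + 1)) {b c : ℕ → B} (h0 : b 0 = c 0)
    (hb : ∀ t < (j : ℕ), coef a b t = 0) (hc : ∀ t < (j : ℕ), coef a c t = 0) :
    coef a b j - coef a c j ∈ ⨆ (i) (_ : i < j), T.R i := by
  rw [← coef_sub]
  obtain ⟨j, hj⟩ := j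
  cases j with
  | zero => simp [coef_zero_index, h0]
  | succ j =>
    -- The roots agree, so `b - c` is divisible by `ε`; the quotient is a curve whose coefficients
    -- are shifted down by one order, which lowers the order of the leading coefficient.
    have h1 : ∀ t, coef a (fun l => (b - c) (l + 1)) t = coef a (b - c) (t + 1) := fun t => by
      rw [coef_succ]; simp [h0]
    have h2 : coef a (b - c) (j + 1) ∈ leadSpace L j := by
      refine (ha.mem_leadSpace_iff (by omega)).2 ⟨fun l => (b - c) (l + 1), fun t ht => ?_, h1 j⟩
      rw [h1, coef_sub, hb _ (by simpa using ht), hc _ (by simpa using ht), sub_zero]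
    have h3 := T.iSup_R ⟨j, by omega⟩
    simp only at h3
    rw [← h3] at h2
    have hle : (⨆ i ≤ (⟨j, by omega⟩ : Fin (k + 1)), T.R i)
        ≤ ⨆ (i) (_ : i < (⟨j + 1, hj⟩ : Fin (k + 1))), T.R i := by
      refine iSup₂_le fun i hi => le_iSup₂ (f := fun i (_ : i < (⟨j + 1, hj⟩ : Fin (k + 1))) => T.R i)
        i ?_
      rw [Fin.le_def] at hi
      rw [Fin.lt_def]
      simp only at hi ⊢
      omega
    exact hle h2

variable (T)

/-- `∑ ε^l ψ_l` continues every element of rank at least `i` to a curve which `L(ε)` maps to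
`ε^i y + O(ε^(i+1))` with `y` in `R_{i+1}`. -/
structure IsChain (a : ℕ → B →L[𝕜] B') (i : Fin (k + 1)) (ψ : ℕ → B →L[𝕜] B) : Prop where
  zero : ψ 0 = ContinuousLinearMap.id 𝕜 B
  range : ∀ l ≠ 0, ∀ x, ψ l x ∈ ⨆ (m : Fin (k + 1)) (_ : (m : ℕ) + l ≤ i), T.Nc m
  coef_lt : ∀ n ∈ rootSpace L i, ∀ t < (i : ℕ), coef a (fun l => ψ l n) t = 0
  coef_mem : ∀ n ∈ rootSpace L i, coef a (fun l => ψ l n) i ∈ T.R i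

variable {T}

lemma eq_zero_of_mem_R [CompleteSpace B'] (hs : KSurjective L k) {j : Fin (k + 1)} {y : B'}
    (hy : y ∈ T.R j) (hy' : y ∈ ⨆ (i) (_ : i < j), T.R i) : y = 0 := by
  have h1 := sumProj_of_mem_biSup T.isClosed_R T.indep_R (T.iSup_R_eq_top hs)
    (p := (· < j)) (lt_irrefl j) hy'
  have h2 := sumProj_self T.isClosed_R T.indep_R (T.iSup_R_eq_top hs) ⟨y, hy⟩
  rw [h1] at h2
  exact (congrArg Subtype.val h2).symm

namespace IsChain

variable {j : Fin (k + 1)} {ψ : ℕ → B →L[𝕜] B}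

/-- If some other curve with root `n` also annihilates order `j`, the chain's coefficient lies in
`R₁ ⊕ ⋯ ⊕ R_j`; it lies in `R_{j+1}` as well, hence vanishes. So the chain continues every root as
far as any curve does, up to this order. -/
lemma coef_eq_zero_iff [CompleteSpace B'] (hψ : T.IsChain a j ψ) (ha : HasExpansion L a k)
    (hs : KSurjective L k) {n : B} (hn : n ∈ rootSpace L j) :
    coef a (fun l => ψ l n) j = 0 ↔ n ∈ rootSpace L (j + 1) := by
  rw [ha.mem_rootSpace_iff (by omega)]
  constructor
  · intro h
    refine ⟨fun l => ψ l n, by simp [hψ.zero], fun t ht => ?_⟩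
    rcases (Nat.lt_succ_iff.1 ht).lt_or_eq with h' | rfl
    · exact hψ.coef_lt n hn t h'
    · exact h
  · rintro ⟨c, hc, hct⟩
    have h := coef_sub_coef_mem (T := T) ha j (b := fun l => ψ l n) (c := c) (by simp [hψ.zero, hc])
      (hψ.coef_lt n hn) (fun t ht => hct t (by omega))
    rw [hct j (by omega), sub_zero] at h
    exact eq_zero_of_mem_R hs (hψ.coef_mem n hn) h

/-- The leading coefficients of a chain give an isomorphism `N_{j+1}ᶜ → R_{j+1}`. -/
lemma exists_equiv [CompleteSpace B] [CompleteSpace B'] (hψ : T.IsChain a j ψ)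
    (ha : HasExpansion L a k) (hs : KSurjective L k) :
    ∃ S : T.Nc j ≃L[𝕜] T.R j, ∀ n : T.Nc j, (S n : B') = coef a (fun l => ψ l n) j := by
  have : CompleteSpace (T.Nc j) := (T.isClosed_N _).completeSpace_coe
  have : CompleteSpace (T.R j) := (T.isClosed_R _).completeSpace_coe
  let S₀ : T.Nc j →L[𝕜] T.R j := (coefOp a ψ j ∘L (T.Nc j).subtypeL).codRestrict (T.R j)
    fun n => by
      rw [ContinuousLinearMap.comp_apply, coefOp_apply]
      exact hψ.coef_mem _ (T.Nc_le_rootSpace j n.2)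
  have hS₀ : ∀ n : T.Nc j, (S₀ n : B') = coef a (fun l => ψ l n) j := fun n => by
    simp [S₀, coefOp_apply]
  have hsum := fun v => sum_sumProj T.isClosed_N T.indep_N (T.iSup_N_eq_top ha) v
  have hker : S₀.ker = ⊥ := by
    rw [LinearMap.ker_eq_bot']
    intro n hn
    have h1 : coef a (fun l => ψ l n) j = 0 := by
      rw [← hS₀]
      simpa using congrArg Subtype.val hn
    rw [hψ.coef_eq_zero_iff ha hs (T.Nc_le_rootSpace j n.2)] at h1
    have h2 := T.iSup_N j.succ
    rw [Fin.val_succ] at h2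
    rw [← h2] at h1
    have h3 := sumProj_of_mem_biSup T.isClosed_N T.indep_N (T.iSup_N_eq_top ha)
      (p := fun i => i ≥ j.succ) (i := j.castSucc) (by simp) h1
    rwa [sumProj_self] at h3
  have hran : S₀.range = ⊤ := by
    rw [eq_top_iff]
    rintro ⟨y, hy⟩ -
    obtain ⟨b, hb, hby⟩ := (ha.mem_leadSpace_iff (by omega)).1 (T.R_le_leadSpace j hy)
    have hb0 : b 0 ∈ rootSpace L j := (ha.mem_rootSpace_iff (by omega)).2 ⟨b, rfl, hb⟩
    -- Replacing `b` by the chain with the same root changes the leading coefficient only within `R₁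
    -- ⊕ ⋯ ⊕ R_j`, and both coefficients lie in `R_{j+1}`.
    have hψy : coef a (fun l => ψ l (b 0)) j = y := by
      have h1 := coef_sub_coef_mem (T := T) ha j (b := fun l => ψ l (b 0)) (c := b)
        (by simp [hψ.zero]) (hψ.coef_lt _ hb0) hb
      rw [hby] at h1
      exact sub_eq_zero.1 (eq_zero_of_mem_R hs ((T.R j).sub_mem (hψ.coef_mem _ hb0) hy) h1)
    set n := sumProj T.isClosed_N T.indep_N (T.iSup_N_eq_top ha) j.castSucc (b 0)
    -- Only the component of `b 0` in `N_{j+1}ᶜ` matters: the components below vanish because `b 0`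
    -- has rank at least `j`, and those above have rank at least `j + 1` and contribute nothing at
    -- order `j`.
    have hrest : b 0 - n ∈ rootSpace L (j + 1) := by
      have h2 := T.iSup_N j.succ
      rw [Fin.val_succ] at h2
      rw [← h2]
      have h3 : b 0 - n = ∑ i ∈ Finset.univ.erase j.castSucc,
          (sumProj T.isClosed_N T.indep_N (T.iSup_N_eq_top ha) i (b 0) : B) := by
        rw [sub_eq_iff_eq_add']
        conv_lhs => rw [← hsum (b 0), ← Finset.add_sum_erase _ _ (Finset.mem_univ j.castSucc)]
      rw [h3]
      refine Submodule.sum_mem _ fun i hi => ?_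
      by_cases hij : i ≥ j.succ
      · exact (le_iSup₂ (f := fun i (_ : i ≥ j.succ) => T.N i) i hij) (Subtype.mem _)
      · rw [sumProj_of_mem_biSup T.isClosed_N T.indep_N (T.iSup_N_eq_top ha)
          (p := fun i => i ≥ j.castSucc)]
        · exact Submodule.zero_mem _
        · intro h
          refine hij (Fin.castSucc_lt_iff_succ_le.1 (lt_of_le_of_ne h ?_))
          exact fun h' => (Finset.ne_of_mem_erase hi) h'.symm
        · rw [T.iSup_N j.castSucc]; exact hb0
    refine ⟨n, Subtype.ext ?_⟩
    have h4 : coef a (fun l => ψ l (b 0 - n)) j = 0 :=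
      (hψ.coef_eq_zero_iff ha hs (Submodule.sub_mem _ hb0 (T.Nc_le_rootSpace j n.2))).2 hrest
    rw [← coefOp_apply, map_sub, sub_eq_zero, coefOp_apply, coefOp_apply, hψy] at h4
    exact (hS₀ n).trans h4.symm
  exact ⟨ContinuousLinearEquiv.ofBijective S₀ hker hran, fun n => hS₀ n⟩

/-- `Q` is the inverse of `S_{j+1}` after projection to `R_{j+1}`: it supplies the roots whose
chains cancel a prescribed component at order `j`. -/
lemma exists_rightInverse [CompleteSpace B] [CompleteSpace B'] (hψ : T.IsChain a j ψ)
    (ha : HasExpansion L a k) (hs : KSurjective L k) :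
    ∃ Q : B' →L[𝕜] B, (∀ y, Q y ∈ T.Nc j) ∧
      ∀ y, coef a (fun l => ψ l (Q y)) j = T.projR hs j y := by
  obtain ⟨S, hS⟩ := hψ.exists_equiv ha hs
  refine ⟨(T.Nc j).subtypeL ∘L (S.symm : T.R j →L[𝕜] T.Nc j) ∘L T.projR hs j,
    fun y => (S.symm (T.projR hs j y)).2, fun y => ?_⟩
  have := hS (S.symm (T.projR hs j y))
  rw [S.apply_symm_apply] at this
  exact this.symm

end IsChain

/-- The chain of index `j - 1` already annihilates all orders below `j` on elements of rank at least
`j`. Its coefficient of order `j` lies in `R₁ ⊕ ⋯ ⊕ R_{j+1}`, and the components in `R₁, …, R_j` are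
removed with the help of the shorter chains. -/
lemma exists_isChain [CompleteSpace B] [CompleteSpace B'] (ha : HasExpansion L a k)
    (hs : KSurjective L k) (j : Fin (k + 1)) : ∃ ψ, T.IsChain a j ψ := by
  induction j using WellFoundedLT.induction with
  | ind j ih =>
  rcases Nat.eq_zero_or_pos (j : ℕ) with hj | hj
  · refine ⟨Pi.single 0 (ContinuousLinearMap.id 𝕜 B), by simp, fun l hl x => ?_, ?_, fun n _ => ?_⟩
    · simp [Pi.single_eq_of_ne hl]
    · simp [hj]
    · have h1 := T.iSup_R j
      obtain rfl : j = 0 := Fin.ext hj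
      have h2 : (⨆ i ≤ (0 : Fin (k + 1)), T.R i) ≤ T.R 0 := by
        refine iSup₂_le fun i hi => ?_
        rw [Fin.le_zero_iff.1 hi]
      refine h2 ?_
      rw [h1]
      exact (ha.mem_leadSpace_iff (by simp)).2 ⟨_, by simp, rfl⟩
  choose! Ψ hΨ using ih
  have hQ : ∀ i < j, ∃ Q : B' →L[𝕜] B, (∀ y, Q y ∈ T.Nc i) ∧
      ∀ y, coef a (fun l => Ψ i l (Q y)) i = T.projR hs i y :=
    fun i hi => (hΨ i hi).exists_rightInverse ha hs
  choose! Q hQN hQ using hQ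
  let j' : Fin (k + 1) := ⟨j - 1, by omega⟩
  have hj'val : (j' : ℕ) = j - 1 := rfl
  have hj' : j' < j := by rw [Fin.lt_def]; omega
  let Δ : B →L[𝕜] B' := coefOp a (Ψ j') j
  -- The chain of index `i` has leading order `i`, so the factor `ε^(j - i)` moves its leading
  -- coefficient, the `R_{i+1}`-component of `Δ`, to order `j` without disturbing lower orders. As
  -- `j - i ≥ 1`, the root is unchanged.
  let ψ : ℕ → B →L[𝕜] B := fun l => Ψ j' l - ∑ i ∈ Finset.univ.filter (· < j),
    if (j : ℕ) - i ≤ l then Ψ i (l - (j - i)) ∘L Q i ∘L Δ else 0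
  have hψ : ∀ n, (fun l => ψ l n) = (fun l => Ψ j' l n) - fun l =>
      ∑ i ∈ Finset.univ.filter (· < j),
        shiftCurve ((j : ℕ) - i) (fun l => Ψ i l (Q i (Δ n))) l := by
    intro n
    ext l
    simp only [ψ, sub_apply, sum_apply, Pi.sub_apply, shiftCurve]
    congr 1
    refine Finset.sum_congr rfl fun i _ => ?_
    split_ifs <;> simp
  have hcoef : ∀ n t, coef a (fun l => ψ l n) t = coef a (fun l => Ψ j' l n) t -
      ∑ i ∈ Finset.univ.filter (· < j),
        if (j : ℕ) - i ≤ t then coef a (fun l => Ψ i l (Q i (Δ n))) (t - (j - i)) else 0 := by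
    intro n t
    rw [hψ, coef_sub, coef_sum]
    simp only [coef_shiftCurve]
  have hroot : ∀ n ∈ rootSpace L j, n ∈ rootSpace L j' := by
    intro n hn
    rw [ha.mem_rootSpace_iff (by omega)] at hn ⊢
    obtain ⟨b, hb, h⟩ := hn
    exact ⟨b, hb, fun t ht => h t (by omega)⟩
  have hprev : ∀ n ∈ rootSpace L j, ∀ t < (j : ℕ), coef a (fun l => Ψ j' l n) t = 0 := by
    intro n hn t ht
    by_cases h : t < j'
    · exact (hΨ j' hj').coef_lt n (hroot n hn) t h
    · obtain rfl : t = j' := by omega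
      refine ((hΨ j' hj').coef_eq_zero_iff ha hs (hroot n hn)).2 ?_
      rwa [show (j' : ℕ) + 1 = j by omega]
  refine ⟨ψ, ?_, fun l hl x => ?_, fun n hn t ht => ?_, fun n hn => ?_⟩
  · ext x
    have h1 := congrFun (hψ x) 0
    simp only [Pi.sub_apply, (hΨ j' hj').zero] at h1
    rw [h1, Finset.sum_eq_zero]
    · simp
    · intro i hi
      have : i < j := (Finset.mem_filter.1 hi).2
      rw [Fin.lt_def] at this
      simp only [shiftCurve]
      rw [if_neg (by omega)]
  · have h1 := congrFun (hψ x) l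
    simp only [Pi.sub_apply] at h1
    rw [h1]
    refine Submodule.sub_mem _ ?_ (Submodule.sum_mem _ fun i hi => ?_)
    · have hle : (⨆ (m : Fin (k + 1)) (_ : (m : ℕ) + l ≤ j'), T.Nc m)
          ≤ ⨆ (m : Fin (k + 1)) (_ : (m : ℕ) + l ≤ j), T.Nc m :=
        biSup_mono fun m hm => by omega
      exact hle ((hΨ j' hj').range l hl x)
    · have hij : i < j := (Finset.mem_filter.1 hi).2
      have hij' := hij
      rw [Fin.lt_def] at hij'
      simp only [shiftCurve]
      split_ifs with hl'
      · rcases Nat.eq_zero_or_pos (l - (j - i)) with h0 | h0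
        · rw [h0, (hΨ i hij).zero]
          exact (le_iSup₂ (f := fun (m : Fin (k + 1)) (_ : (m : ℕ) + l ≤ j) => T.Nc m) i
            (by omega)) (hQN i hij _)
        · have hle : (⨆ (m : Fin (k + 1)) (_ : (m : ℕ) + (l - (j - i)) ≤ i), T.Nc m)
              ≤ ⨆ (m : Fin (k + 1)) (_ : (m : ℕ) + l ≤ j), T.Nc m :=
            biSup_mono fun m hm => by omega
          exact hle ((hΨ i hij).range _ h0.ne' _)
      · exact Submodule.zero_mem _
  · rw [hcoef, hprev n hn t ht, Finset.sum_eq_zero, sub_zero]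
    intro i hi
    have hij : i < j := (Finset.mem_filter.1 hi).2
    have hij' := hij
    rw [Fin.lt_def] at hij'
    split_ifs
    · exact (hΨ i hij).coef_lt _ (T.Nc_le_rootSpace i (hQN i hij _)) _ (by omega)
    · rfl
  · rw [hcoef]
    have hΔ : coef a (fun l => Ψ j' l n) j = Δ n := (coefOp_apply _ _ _ _).symm
    have hsum : ∀ i ∈ Finset.univ.filter (· < j),
        (if (j : ℕ) - i ≤ j then coef a (fun l => Ψ i l (Q i (Δ n))) (j - (j - i)) else 0)
          = (T.projR hs i (Δ n) : B') := by
      intro i hi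
      have hij : i < j := (Finset.mem_filter.1 hi).2
      have hij' := hij
      rw [Fin.lt_def] at hij'
      rw [if_pos (by omega), show (j : ℕ) - (j - i) = i by omega, hQ i hij]
    rw [Finset.sum_congr rfl hsum, hΔ]
    have hlead : Δ n ∈ leadSpace L j :=
      (ha.mem_leadSpace_iff (by omega)).2 ⟨fun l => Ψ j' l n, hprev n hn, hΔ⟩
    have hzero : ∀ i, ¬ i ≤ j → T.projR hs i (Δ n) = 0 := fun i hi => by
      rw [← T.iSup_R j] at hlead
      exact sumProj_of_mem_biSup T.isClosed_R T.indep_R (T.iSup_R_eq_top hs)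
        (p := (· ≤ j)) hi hlead
    have htot : ∑ i, (T.projR hs i (Δ n) : B') = Δ n :=
      sum_sumProj T.isClosed_R T.indep_R (T.iSup_R_eq_top hs) (Δ n)
    have hsplit : Δ n = ∑ i ∈ Finset.univ.filter (· < j), (T.projR hs i (Δ n) : B')
        + T.projR hs j (Δ n) := by
      conv_lhs => rw [← htot]
      rw [← Finset.sum_filter_add_sum_filter_not Finset.univ (· < j)]
      congr 1
      rw [Finset.sum_eq_single j]
      · intro i hi hij
        rw [hzero i, Submodule.coe_zero]
        intro h
        exact (Finset.mem_filter.1 hi).2 (lt_of_le_of_ne h hij)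
      · simp
    have : Δ n - ∑ i ∈ Finset.univ.filter (· < j), (T.projR hs i (Δ n) : B')
        = T.projR hs j (Δ n) := by
      rw [sub_eq_iff_eq_add']; exact hsplit
    rw [this]
    exact Subtype.mem _

lemma sum_fin_eq_polyCurve {E : Type*} [NormedAddCommGroup E] [NormedSpace 𝕜 E] (c : ℕ → E)
    (k : ℕ) (ε : 𝕜) : ∑ j : Fin (k + 1), ε ^ (j : ℕ) • c j = polyCurve c k ε := by
  rw [polyCurve, Finset.sum_range]

/-- On each summand of `B` the chain adapted to its rank is used; composing with the bounded
projections of the direct sum glues them to operators on `B`. -/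
lemma nonempty_chainFamily [CompleteSpace B] [CompleteSpace B'] (ha : HasExpansion L a k)
    (hs : KSurjective L k) : Nonempty T.ChainFamily := by
  choose Ψ hΨ using exists_isChain (T := T) ha hs
  choose S hS using fun j => (hΨ j).exists_equiv ha hs
  let π := sumProj T.isClosed_N T.indep_N (T.iSup_N_eq_top ha)
  -- The last summand `N_{k+1}` shares the chain of `N_{k+1}ᶜ`, whose coefficient of order `k`
  -- vanishes on elements of rank `k + 1`.
  let J : Fin (k + 2) → Fin (k + 1) := Fin.lastCases (Fin.last k) id
  have hJ : ∀ j : Fin (k + 1), J j.castSucc = j := fun j => by simp [J]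
  have hJlast : J (Fin.last (k + 1)) = Fin.last k := by simp [J]
  let φ : ℕ → B →L[𝕜] B := fun l => ∑ j, Ψ (J j) l ∘L (T.N j).subtypeL ∘L π j
  have hφ : ∀ (j : Fin (k + 2)) (n : T.N j) (l : ℕ), φ l n = Ψ (J j) l n := by
    intro j n l
    simp only [φ, sum_apply, ContinuousLinearMap.comp_apply]
    rw [Finset.sum_eq_single j]
    · rw [show π j n = n from sumProj_self _ _ _ n]; rfl
    · intro i _ hij
      rw [show π i n = 0 from sumProj_of_ne _ _ _ hij n.2]
      simp
    · simp
  refine ⟨⟨fun l => φ l, S, ?_, fun l hl x => ?_, fun i n => ?_, fun n => ?_⟩⟩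
  · ext x
    have := sum_sumProj T.isClosed_N T.indep_N (T.iSup_N_eq_top ha) x
    simpa [φ, (hΨ _).zero] using this
  · simp only [φ, sum_apply, ContinuousLinearMap.comp_apply]
    refine Submodule.sum_mem _ fun j _ => ?_
    have hle : (⨆ (m : Fin (k + 1)) (_ : (m : ℕ) + l ≤ J j), T.Nc m)
        ≤ ⨆ (m : Fin (k + 1)) (_ : (m : ℕ) + l < k + 1), T.Nc m :=
      biSup_mono fun m hm => by omega
    exact hle ((hΨ _).range l (by simpa using Fin.val_ne_of_ne hl) _)
  · have hn := T.Nc_le_rootSpace i n.2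
    have h1 := (ha.apply_isBigO le_rfl (fun l => Ψ i l n)).trans
      (isBigO_pow_pow_of_le (m := i + 1) (by omega))
    have h2 := polyCurve_tail_isBigO (𝕜 := 𝕜) (coef a (fun l => Ψ i l n)) (Nat.lt_succ_iff.1 i.2)
    refine (h1.add h2).congr_left fun ε => ?_
    have h3 : polyCurve (coef a (fun l => Ψ i l n)) i ε = ε ^ (i : ℕ) • (S i n : B') := by
      rw [← polyCurve_single]
      refine polyCurve_congr (fun t ht => ?_) ε
      rcases ht.lt_or_eq with ht | rfl
      · rw [Pi.single_eq_of_ne ht.ne, (hΨ i).coef_lt _ hn t ht]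
      · rw [Pi.single_eq_same, hS]
    have h4 := sum_fin_eq_polyCurve (fun l => Ψ i l n) k ε
    simp only [hφ i.castSucc n, hJ, h3, h4]
    abel
  · have hn : (n : B) ∈ rootSpace L (k + 1) := by
      simpa using T.N_le_rootSpace (Fin.last (k + 1)) n.2
    have hn' : (n : B) ∈ rootSpace L (Fin.last k : Fin (k + 1)) := by
      rw [ha.mem_rootSpace_iff (by simp)]
      obtain ⟨b, hb, h⟩ := (ha.mem_rootSpace_iff le_rfl).1 hn
      exact ⟨b, hb, fun t ht => h t (by simp at ht; omega)⟩
    refine (ha.apply_isBigO le_rfl (fun l => Ψ (Fin.last k) l n)).congr_left fun ε => ?_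
    have h4 := sum_fin_eq_polyCurve (fun l => Ψ (Fin.last k) l n) k ε
    simp only [hφ (Fin.last (k + 1)) n, hJlast, h4]
    rw [polyCurve_eq_zero (c := coef a _), sub_zero]
    intro t ht
    rcases ht.lt_or_eq with ht | rfl
    · exact (hΨ (Fin.last k)).coef_lt _ hn' t (by simpa using ht)
    · exact ((hΨ (Fin.last t)).coef_eq_zero_iff ha hs hn').2 (by simpa using hn)

end JordanScheme

/-! ### From pointwise expansions to the operator norm -/

section OperatorExpansion

variable {𝕜 : Type*} [RCLike 𝕜]
  {E : Type*} [NormedAddCommGroup E] [NormedSpace 𝕜 E]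
  {F : Type*} [NormedAddCommGroup F] [NormedSpace 𝕜 F]
  {H : Type*} [NormedAddCommGroup H] [NormedSpace 𝕜 H]

/-- Left composition with `L(ε)` is itself an operator family with an expansion, acting on operators
`H → E`, so the vector-valued estimate applies to it. -/
lemma HasExpansion.comp_polyCurve_isBigO {L : 𝕜 → E →L[𝕜] F} {a : ℕ → E →L[𝕜] F} {k : ℕ}
    (ha : HasExpansion L a k) (ψ : ℕ → H →L[𝕜] E) :
    (fun ε => L ε ∘L polyCurve ψ k ε - polyCurve (coefOp a ψ) k ε) =O[𝓝 0]
      fun ε : 𝕜 => ε ^ (k + 1) := by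
  let C := ContinuousLinearMap.compL 𝕜 H E F
  have hC : HasExpansion (fun ε => C (L ε)) (fun t => C (a t)) k := by
    intro i hi
    refine IsBigO.trans ?_ (ha i hi)
    refine (C.isBigO_comp (fun ε => L ε - polyCurve a i ε) (𝓝 0)).congr_left fun ε => ?_
    simp [polyCurve]
  refine (hC.apply_isBigO le_rfl ψ).congr_left fun ε => ?_
  rfl

/-- If a family of operators has an expansion in the operator norm, then a pointwise leading
term is a leading term in the operator norm. -/
lemma isBigO_sub_of_pointwise {f : 𝕜 → H →L[𝕜] F} {A : ℕ → H →L[𝕜] F} {k i : ℕ} (hi : i ≤ k)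
    (hf : (fun ε => f ε - polyCurve A k ε) =O[𝓝 0] fun ε : 𝕜 => ε ^ (k + 1)) (S : H →L[𝕜] F)
    (hS : ∀ n, (fun ε => f ε n - ε ^ i • S n) =O[𝓝 0] fun ε : 𝕜 => ε ^ (i + 1)) :
    (fun ε => f ε - ε ^ i • S) =O[𝓝 0] fun ε : 𝕜 => ε ^ (i + 1) := by
  have h1 : (fun ε => f ε - polyCurve A i ε) =O[𝓝 0] fun ε : 𝕜 => ε ^ (i + 1) := by
    refine ((hf.trans (isBigO_pow_pow_of_le (by omega))).add
      (polyCurve_tail_isBigO A hi)).congr_left fun ε => ?_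
    abel
  have h2 : ∀ t ≤ i, A t = (Pi.single i S : ℕ → H →L[𝕜] F) t := by
    intro t ht
    ext n
    have h3 : polyCurve (fun t => A t n - (Pi.single i S : ℕ → H →L[𝕜] F) t n) i =O[𝓝 0]
        fun ε : 𝕜 => ε ^ (i + 1) := by
      refine ((hS n).sub (isBigO_clm_apply_const h1 n)).congr_left fun ε => ?_
      have h4 : polyCurve (fun t => A t n - (Pi.single i S : ℕ → H →L[𝕜] F) t n) i ε
          = (polyCurve A i ε - polyCurve (Pi.single i S) i ε) n := by
        simp [polyCurve, smul_sub]
      rw [h4, polyCurve_single]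
      simp
    exact sub_eq_zero.1 (eq_zero_of_polyCurve_isBigO (h3.mono nhdsWithin_le_nhds) t ht)
  refine h1.congr_left fun ε => ?_
  rw [polyCurve_congr h2, polyCurve_single]

end OperatorExpansion

/-! ### Uniform chain estimates for an arbitrary choice of `φ_j`, `S_j` -/

namespace JordanScheme.ChainFamily

variable {𝕜 : Type*} [RCLike 𝕜]
  {B : Type*} [NormedAddCommGroup B] [NormedSpace 𝕜 B]
  {B' : Type*} [NormedAddCommGroup B'] [NormedSpace 𝕜 B']
  {L : 𝕜 → B →L[𝕜] B'} {k : ℕ} {a : ℕ → B →L[𝕜] B'} {T : JordanScheme L k}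
  (Φ : T.ChainFamily)

/-- The coefficients of `p(ε)`, extended by zero. -/
def coeff (l : ℕ) : B →L[𝕜] B := if h : l < k + 1 then Φ.φ ⟨l, h⟩ else 0

lemma p_eq_polyCurve (ε : 𝕜) : Φ.p ε = polyCurve Φ.coeff k ε := by
  rw [← sum_fin_eq_polyCurve, p]
  exact Finset.sum_congr rfl fun j _ => by rw [coeff, dif_pos j.2]

lemma p_apply (ε : 𝕜) (x : B) : Φ.p ε x = ∑ j : Fin (k + 1), ε ^ (j : ℕ) • Φ.φ j x := by
  simp [p]

lemma p_zero : Φ.p 0 = ContinuousLinearMap.id 𝕜 B := by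
  rw [p, Finset.sum_eq_single 0]
  · simp [Φ.φ_zero]
  · intro j _ hj
    simp [zero_pow (by simpa using Fin.val_ne_of_ne hj : (j : ℕ) ≠ 0)]
  · simp

lemma comp_p_isBigO (ha : HasExpansion L a k) {H : Type*} [NormedAddCommGroup H] [NormedSpace 𝕜 H]
    (ι : H →L[𝕜] B) :
    (fun ε => L ε ∘L Φ.p ε ∘L ι - polyCurve (fun t => coefOp a Φ.coeff t ∘L ι) k ε) =O[𝓝 0]
      fun ε : 𝕜 => ε ^ (k + 1) := by
  let C := (ContinuousLinearMap.compL 𝕜 H B B').flip ι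
  refine IsBigO.trans ?_ (ha.comp_polyCurve_isBigO Φ.coeff)
  refine (C.isBigO_comp (fun ε => L ε ∘L polyCurve Φ.coeff k ε -
    polyCurve (coefOp a Φ.coeff) k ε) (𝓝 0)).congr_left fun ε => ?_
  rw [p_eq_polyCurve, map_sub]
  congr 1
  simp [polyCurve, C]

/-- The defining property is pointwise in `n`, but the Lipschitz estimates need it uniformly on
bounded sets. Uniformity is automatic, since the composed family has an expansion in operator norm.
-/
lemma chain_opNorm (ha : HasExpansion L a k) (i : Fin (k + 1)) :
    (fun ε => L ε ∘L Φ.p ε ∘L (T.Nc i).subtypeL -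
      ε ^ (i : ℕ) • ((T.R i).subtypeL ∘L (Φ.S i : T.Nc i →L[𝕜] T.R i))) =O[𝓝 0]
      fun ε : 𝕜 => ε ^ ((i : ℕ) + 1) := by
  refine isBigO_sub_of_pointwise (Nat.lt_succ_iff.1 i.2) (Φ.comp_p_isBigO ha _) _ fun n => ?_
  refine (Φ.chain i n).congr_left fun ε => ?_
  rw [← p_apply]
  rfl

lemma chain_last_opNorm (ha : HasExpansion L a k) :
    (fun ε => L ε ∘L Φ.p ε ∘L T.Nlast.subtypeL) =O[𝓝 0] fun ε : 𝕜 => ε ^ (k + 1) := by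
  refine (isBigO_sub_of_pointwise le_rfl (Φ.comp_p_isBigO ha T.Nlast.subtypeL) 0
    fun n => ?_).congr_left fun ε => by simp
  refine (Φ.chain_last n).congr_left fun ε => ?_
  rw [← p_apply]
  simp

end JordanScheme.ChainFamily

/-! ### Contractions with a smooth parameter -/

section FixedPoint

open Set

variable {𝕜 : Type*} [RCLike 𝕜] {P : Type*} [NormedAddCommGroup P] [NormedSpace 𝕜 P]
  [CompleteSpace P] {X : Type*} [NormedAddCommGroup X] [NormedSpace 𝕜 X] [CompleteSpace X]

/-- The closed ball is mapped into the ball of radius `ρ/2 + ρ/4 < ρ`, which makes the bound on the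
fixed point strict. -/
lemma exists_fixedPoint_of_half_contraction {f : X → X} {ρ : ℝ} (hρ : 0 < ρ)
    (hf : ∀ x y, ‖x‖ ≤ ρ → ‖y‖ ≤ ρ → ‖f x - f y‖ ≤ 1 / 2 * ‖x - y‖) (h0 : ‖f 0‖ ≤ ρ / 4) :
    ∃ x, ‖x‖ < ρ ∧ f x = x ∧ ∀ y, ‖y‖ ≤ ρ → f y = y → y = x := by
  have hb : ∀ x, ‖x‖ ≤ ρ → ‖f x‖ ≤ 3 / 4 * ρ := fun x hx => by
    have h1 := hf x 0 hx (by simpa using hρ.le)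
    have h2 : ‖f x‖ ≤ ‖f x - f 0‖ + ‖f 0‖ := by simpa using norm_add_le (f x - f 0) (f 0)
    rw [sub_zero] at h1
    linarith
  have hmaps : MapsTo f (Metric.closedBall 0 ρ) (Metric.closedBall 0 ρ) := fun x hx => by
    rw [mem_closedBall_zero_iff] at hx ⊢
    linarith [hb x hx]
  have hcontr : ContractingWith (1 / 2) (hmaps.restrict f _ _) := by
    refine ⟨by norm_num [← NNReal.coe_lt_coe], LipschitzWith.of_dist_le_mul fun x y => ?_⟩
    have := hf x y (mem_closedBall_zero_iff.1 x.2) (mem_closedBall_zero_iff.1 y.2)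
    simpa [Subtype.dist_eq, dist_eq_norm] using this
  obtain ⟨x, hx, hfx, -⟩ := hcontr.exists_fixedPoint' Metric.isClosed_closedBall.isComplete hmaps
    (x := 0) (Metric.mem_closedBall_self hρ.le) (edist_ne_top _ _)
  rw [mem_closedBall_zero_iff] at hx
  have hfx' : f x = x := hfx
  refine ⟨x, ?_, hfx', fun y hy hfy => ?_⟩
  · have := hb x hx
    rw [hfx'] at this
    linarith
  · have := hf y x hy hx
    rw [hfy, hfx'] at this
    have h0 : ‖y - x‖ = 0 := le_antisymm (by linarith [norm_nonneg (y - x)]) (norm_nonneg _)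
    exact sub_eq_zero.1 (norm_eq_zero.1 h0)

/-- The fixed point of a contraction depends as smoothly on a parameter as the contraction. -/
lemma exists_contDiffOn_fixedPoint {n : WithTop ℕ∞} (hn : n ≠ 0) {Ω : Set P} (hΩ : IsOpen Ω)
    {Ψ : P × X → X} (hΨ : ContDiffOn 𝕜 n Ψ (Ω ×ˢ univ)) {ρ : ℝ} (hρ : 0 < ρ)
    (hc : ∀ p ∈ Ω, ∀ x y, ‖x‖ ≤ ρ → ‖y‖ ≤ ρ → ‖Ψ (p, x) - Ψ (p, y)‖ ≤ 1 / 2 * ‖x - y‖)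
    (h0 : ∀ p ∈ Ω, ‖Ψ (p, 0)‖ ≤ ρ / 4) :
    ∃ f : P → X, ContDiffOn 𝕜 n f Ω ∧ ∀ p ∈ Ω, ‖f p‖ < ρ ∧ Ψ (p, f p) = f p ∧
      ∀ x, ‖x‖ ≤ ρ → Ψ (p, x) = x → x = f p := by
  have hex := fun p hp => exists_fixedPoint_of_half_contraction (f := fun x => Ψ (p, x)) hρ
    (hc p hp) (h0 p hp)
  choose! f hf1 hf2 hf3 using hex
  refine ⟨f, fun p₀ hp₀ => ContDiffAt.contDiffWithinAt ?_,
    fun p hp => ⟨hf1 p hp, hf2 p hp, hf3 p hp⟩⟩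
  have hΩ' : IsOpen (Ω ×ˢ (univ : Set X)) := hΩ.prod isOpen_univ
  have hmem : (p₀, f p₀) ∈ Ω ×ˢ (univ : Set X) := ⟨hp₀, mem_univ _⟩
  have hΨ₀ : ContDiffAt 𝕜 n Ψ (p₀, f p₀) := hΨ.contDiffAt (hΩ'.mem_nhds hmem)
  have hdΨ : HasFDerivAt Ψ (fderiv 𝕜 Ψ (p₀, f p₀)) (p₀, f p₀) :=
    (hΨ₀.differentiableAt hn).hasFDerivAt
  set A : X →L[𝕜] X := fderiv 𝕜 Ψ (p₀, f p₀) ∘L .inr 𝕜 P X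
  -- The Lipschitz constant bounds the partial derivative, so `1 - A` is invertible by a Neumann
  -- series and the implicit function theorem applies to `x - Ψ(p, x)`.
  have hA : ‖A‖ ≤ 1 / 2 := by
    have h1 : HasFDerivAt (fun x => Ψ (p₀, x)) A (f p₀) :=
      hdΨ.comp (f p₀) (hasFDerivAt_prodMk_right p₀ (f p₀))
    have h2 : LipschitzOnWith (1 / 2) (fun x => Ψ (p₀, x)) (Metric.closedBall 0 ρ) := by
      refine LipschitzOnWith.of_dist_le_mul fun x hx y hy => ?_
      simpa [dist_eq_norm] using
        hc p₀ hp₀ x y (mem_closedBall_zero_iff.1 hx) (mem_closedBall_zero_iff.1 hy)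
    have h3 : Metric.closedBall (0 : X) ρ ∈ 𝓝 (f p₀) :=
      mem_of_superset (Metric.isOpen_ball.mem_nhds (mem_ball_zero_iff.2 (hf1 p₀ hp₀)))
        Metric.ball_subset_closedBall
    simpa using h1.le_of_lipschitzOn h3 h2
  have hg : ContDiffAt 𝕜 n (fun q : P × X => q.2 - Ψ q) (p₀, f p₀) := contDiffAt_snd.sub hΨ₀
  have hgd : fderiv 𝕜 (fun q : P × X => q.2 - Ψ q) (p₀, f p₀) ∘L .inr 𝕜 P X = 1 - A := by
    have h1 : HasFDerivAt (fun q : P × X => q.2 - Ψ q)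
        (.snd 𝕜 P X - fderiv 𝕜 Ψ (p₀, f p₀)) (p₀, f p₀) := hasFDerivAt_snd.sub hdΨ
    rw [h1.fderiv]
    ext x
    simp [A]
  have hinv : (fderiv 𝕜 (fun q : P × X => q.2 - Ψ q) (p₀, f p₀) ∘L .inr 𝕜 P X).IsInvertible := by
    rw [hgd]
    exact ⟨ContinuousLinearEquiv.unitsEquiv 𝕜 X (Units.oneSub A (by linarith)), rfl⟩
  have hself : hg.implicitFunction hn hinv p₀ = f p₀ := hg.implicitFunction_apply_self hn hinv
  have hsmooth : ContDiffAt 𝕜 n (hg.implicitFunction hn hinv) p₀ :=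
    hg.contDiffAt_implicitFunction hn hinv
  refine hsmooth.congr_of_eventuallyEq ?_
  have hev : ∀ᶠ p in 𝓝 p₀, hg.implicitFunction hn hinv p - Ψ (p, hg.implicitFunction hn hinv p)
      = f p₀ - Ψ (p₀, f p₀) := hg.eventually_apply_implicitFunction hn hinv
  -- The implicit function stays in the ball where fixed points are unique, hence coincides with `f`
  -- near `p₀`.
  have hnorm : ∀ᶠ p in 𝓝 p₀, ‖hg.implicitFunction hn hinv p‖ < ρ := by
    refine hsmooth.continuousAt.norm.eventually (gt_mem_nhds ?_)
    simpa only [hself] using hf1 p₀ hp₀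
  filter_upwards [hev, hnorm, hΩ.mem_nhds hp₀] with p h1 h2 h3
  rw [hf2 p₀ hp₀, sub_self, sub_eq_zero] at h1
  exact (hf3 p h3 _ h2.le h1.symm).symm

end FixedPoint

/-! ### Size of the nonlinear part of `G` along the curve -/

section Nonlinearity

variable {𝕜 : Type*} [RCLike 𝕜]
  {B : Type*} [NormedAddCommGroup B] [NormedSpace 𝕜 B]
  {B' : Type*} [NormedAddCommGroup B'] [NormedSpace 𝕜 B']

/-- By continuity the derivative of order `i + 2` is bounded by `M + 1` near `0`. Each descent to a
lower derivative that vanishes at `0` gains a factor `‖v‖` by the mean value inequality, and `i`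
descents lead to order two. -/
lemma exists_norm_fderiv_fderiv_le {G : B → B'} {i : ℕ} (hG : ContDiff 𝕜 (i + 2 : ℕ) G)
    (h0 : ∀ j : ℕ, 2 ≤ j → j ≤ i + 1 → iteratedFDeriv 𝕜 j G 0 = 0) {M : ℝ}
    (hM : ‖iteratedFDeriv 𝕜 (i + 2) G 0‖ ≤ M) :
    ∃ r > 0, ∀ v, ‖v‖ < r → ‖fderiv 𝕜 (fderiv 𝕜 G) v‖ ≤ (M + 1) * ‖v‖ ^ i := by
  let : NormedSpace ℝ B := NormedSpace.restrictScalars ℝ 𝕜 B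
  have hcont : ContinuousAt (fun v => ‖iteratedFDeriv 𝕜 (i + 2) G v‖) 0 :=
    (hG.continuous_iteratedFDeriv le_rfl).norm.continuousAt
  obtain ⟨r, hr, hball⟩ := Metric.eventually_nhds_iff_ball.1
    (hcont.eventually (gt_mem_nhds (lt_of_le_of_lt hM (lt_add_one M))))
  refine ⟨r, hr, ?_⟩
  have hM1 : 0 ≤ M + 1 := by linarith [(norm_nonneg _).trans hM]
  have key : ∀ d ≤ i, ∀ v, ‖v‖ < r →
      ‖iteratedFDeriv 𝕜 (i + 2 - d) G v‖ ≤ (M + 1) * ‖v‖ ^ d := by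
    intro d hd
    induction d with
    | zero => intro v hv; simpa using (hball v (mem_ball_zero_iff.2 hv)).le
    | succ d ih =>
      intro v hv
      have hsucc : i + 2 - d = (i + 2 - (d + 1)) + 1 := by omega
      have hdiff : Differentiable 𝕜 (iteratedFDeriv 𝕜 (i + 2 - (d + 1)) G) :=
        hG.differentiable_iteratedFDeriv (by exact_mod_cast (by omega : i + 2 - (d + 1) < i + 2))
      have h1 := (convex_closedBall (0 : B) ‖v‖).norm_image_sub_le_of_norm_fderiv_le (𝕜 := 𝕜)
        (f := iteratedFDeriv 𝕜 (i + 2 - (d + 1)) G) (C := (M + 1) * ‖v‖ ^ d)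
        (x := 0) (y := v) (fun x _ => hdiff x) (fun x hx => ?_) (by simp) (by simp)
      · rw [h0 _ (by omega) (by omega), sub_zero, sub_zero] at h1
        rwa [pow_succ, ← mul_assoc]
      · rw [mem_closedBall_zero_iff] at hx
        rw [norm_fderiv_iteratedFDeriv, ← hsucc]
        refine (ih (by omega) x (hx.trans_lt hv)).trans ?_
        gcongr
  intro v hv
  have h2 := key i le_rfl v hv
  rw [show i + 2 - i = 1 + 1 by omega, ← norm_iteratedFDeriv_fderiv,
    norm_iteratedFDeriv_one] at h2
  exact h2

/-- The part of order at least two of `y ↦ G(z(ε) + ε^s y)` has a Lipschitz constant of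
order `ε^(i + 2 s)` which is small on small balls. -/
lemma exists_nonlinear_lipschitz {G : B → B'} {i s : ℕ} (hs : 1 ≤ s)
    (hG : ContDiff 𝕜 (i + 2 : ℕ) G) {M M' r₀ : ℝ} (hr₀ : 0 < r₀) (hM : 0 ≤ M) (hM' : 0 ≤ M')
    (hG2 : ∀ v, ‖v‖ < r₀ → ‖fderiv 𝕜 (fderiv 𝕜 G) v‖ ≤ M * ‖v‖ ^ i)
    {z : 𝕜 → B} (hz : ∀ᶠ ε in 𝓝 0, ‖z ε‖ ≤ M' * ‖ε‖) {r : ℝ} (hr : 0 ≤ r) :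
    ∀ᶠ ε in 𝓝 (0 : 𝕜), ∀ y y', ‖y‖ ≤ r → ‖y'‖ ≤ r →
      ‖(G (z ε + ε ^ s • y) - ε ^ s • fderiv 𝕜 G (z ε) y) -
        (G (z ε + ε ^ s • y') - ε ^ s • fderiv 𝕜 G (z ε) y')‖ ≤
      ‖ε‖ ^ (i + 2 * s) * (M * (M' + r) ^ i * r) * ‖y - y'‖ := by
  let : NormedSpace ℝ B := NormedSpace.restrictScalars ℝ 𝕜 B
  have h1 : ∀ᶠ ε in 𝓝 (0 : 𝕜), ‖ε‖ < 1 := by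
    filter_upwards [Metric.ball_mem_nhds (0 : 𝕜) one_pos] with ε hε
    exact mem_ball_zero_iff.1 hε
  have h2 : ∀ᶠ ε in 𝓝 (0 : 𝕜), (M' + r) * ‖ε‖ < r₀ := by
    have : Tendsto (fun ε : 𝕜 => (M' + r) * ‖ε‖) (𝓝 0) (𝓝 0) := by
      have h : Continuous fun ε : 𝕜 => (M' + r) * ‖ε‖ := by fun_prop
      simpa only [norm_zero, mul_zero] using h.tendsto 0
    exact this.eventually (gt_mem_nhds hr₀)
  filter_upwards [hz, h1, h2] with ε hz h1 h2 y y' hy hy'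
  -- Here `s ≥ 1` enters: the displacement in the cone is at most of the order of `z(ε)`, so all
  -- points have norm `O(ε)`.
  have hεs : ‖ε‖ ^ s ≤ ‖ε‖ := pow_le_of_le_one (norm_nonneg _) h1.le (by omega)
  have hG1 : Differentiable 𝕜 G := hG.differentiable (by simp)
  have hG' : Differentiable 𝕜 (fderiv 𝕜 G) :=
    (hG.fderiv_right (m := 1) (by norm_cast; omega)).differentiable (by simp)
  have hball : ∀ y, ‖y‖ ≤ r → ‖z ε + ε ^ s • y‖ ≤ (M' + r) * ‖ε‖ := fun y hy => by
    calc ‖z ε + ε ^ s • y‖ ≤ ‖z ε‖ + ‖ε ^ s • y‖ := norm_add_le _ _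
      _ ≤ M' * ‖ε‖ + ‖ε‖ * r := by
        rw [norm_smul, norm_pow]
        gcongr
      _ = (M' + r) * ‖ε‖ := by ring
  have hder : ∀ y, ‖y‖ ≤ r → ‖fderiv 𝕜 G (z ε + ε ^ s • y) - fderiv 𝕜 G (z ε)‖ ≤
      M * ((M' + r) * ‖ε‖) ^ i * (‖ε‖ ^ s * r) := by
    intro y hy
    have h3 := (convex_closedBall (0 : B) ((M' + r) * ‖ε‖)).norm_image_sub_le_of_norm_fderiv_le
      (𝕜 := 𝕜) (f := fderiv 𝕜 G) (C := M * ((M' + r) * ‖ε‖) ^ i)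
      (x := z ε) (y := z ε + ε ^ s • y) (fun x _ => hG' x) (fun x hx => ?_) ?_ ?_
    · refine h3.trans ?_
      rw [add_sub_cancel_left, norm_smul, norm_pow]
      gcongr
    · rw [mem_closedBall_zero_iff] at hx
      refine (hG2 x (hx.trans_lt h2)).trans ?_
      gcongr
    · simpa using hball 0 (by simpa using hr)
    · simpa using hball y hy
  -- The derivative in `y` is `ε^s (G'[z + ε^s y] - G'[z])`; one factor `ε^s` comes from the chain
  -- rule, the other from the mean value inequality for `G'`.
  have h4 := (convex_closedBall (0 : B) r).norm_image_sub_le_of_norm_hasFDerivWithin_le (𝕜 := 𝕜)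
    (f := fun y => G (z ε + ε ^ s • y) - ε ^ s • fderiv 𝕜 G (z ε) y)
    (f' := fun y => ε ^ s • (fderiv 𝕜 G (z ε + ε ^ s • y) - fderiv 𝕜 G (z ε)))
    (C := ‖ε‖ ^ s * (M * ((M' + r) * ‖ε‖) ^ i * (‖ε‖ ^ s * r))) (x := y') (y := y)
    (fun x _ => ?_) (fun x hx => ?_) (by simpa using hy') (by simpa using hy)
  · refine h4.trans (le_of_eq ?_)
    rw [mul_pow, pow_add, two_mul, pow_add]
    ring
  · have h5 : HasFDerivAt (fun y => z ε + ε ^ s • y) (ε ^ s • ContinuousLinearMap.id 𝕜 B) x :=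
      ((hasFDerivAt_id x).const_smul (ε ^ s)).const_add (z ε)
    have h6 := ((hG1 _).hasFDerivAt.comp x h5).sub
      ((fderiv 𝕜 G (z ε)).hasFDerivAt.const_smul (ε ^ s))
    refine (h6.congr_fderiv ?_).hasFDerivWithinAt
    ext v
    simp [smul_sub]
  · rw [norm_smul, norm_pow]
    gcongr
    exact hder x (by simpa using hx)

end Nonlinearity

/-! ### The fixed point problem after rescaling components -/

section DilatedFixedPoint

open Set

variable {𝕜 : Type*} [RCLike 𝕜] {ι : Type*} [Fintype ι] [DecidableEq ι]
  {N : ι → Type*} [∀ j, NormedAddCommGroup (N j)] [∀ j, NormedSpace 𝕜 (N j)]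
  {E : Type*} [NormedAddCommGroup E] [NormedSpace 𝕜 E]
  {Y : Type*} [NormedAddCommGroup Y] [NormedSpace 𝕜 Y]

/-- Multiplication of all components except the one with index `l` by `t`. -/
def dilate (l : ι) (t : 𝕜) : ((j : ι) → N j) →L[𝕜] (j : ι) → N j :=
  ContinuousLinearMap.pi fun j => (if j = l then (1 : 𝕜) else t) •
    ContinuousLinearMap.proj (R := 𝕜) (φ := N) j

lemma dilate_apply (l : ι) (t : 𝕜) (x : (j : ι) → N j) (j : ι) :
    dilate l t x j = (if j = l then (1 : 𝕜) else t) • x j := rfl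

lemma dilate_apply_self (l : ι) (t : 𝕜) (x : (j : ι) → N j) : dilate l t x l = x l := by
  simp [dilate_apply]

lemma dilate_inv_dilate (l : ι) {t : 𝕜} (ht : t ≠ 0) (x : (j : ι) → N j) :
    dilate l t⁻¹ (dilate l t x) = x := by
  ext j
  simp only [dilate_apply]
  split_ifs <;> simp [smul_smul, ht]

lemma dilate_dilate_inv (l : ι) {t : 𝕜} (ht : t ≠ 0) (x : (j : ι) → N j) :
    dilate l t (dilate l t⁻¹ x) = x := by
  simpa using dilate_inv_dilate l (inv_ne_zero ht) x

lemma norm_dilate_le {l : ι} {t : 𝕜} {x : (j : ι) → N j} {C : ℝ} (hC : 0 ≤ C) (h1 : ‖x l‖ ≤ C)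
    (h2 : ∀ j, ‖t‖ * ‖x j‖ ≤ C) : ‖dilate l t x‖ ≤ C := by
  rw [pi_norm_le_iff_of_nonneg hC]
  intro j
  rw [dilate_apply]
  split_ifs with h
  · subst h; simpa using h1
  · rw [norm_smul]; exact h2 j

/-- The map whose fixed points `μ` correspond to the solutions `ν` of `S ν + H(ε, ν, n) = 0`, where
`ν` arises from `μ` by dividing all components except the one with index `l` by `θ`. -/
def dilatedMap (S : ((j : ι) → N j) ≃L[𝕜] Y) (H : 𝕜 × (((j : ι) → N j) × E) → Y) (l : ι) (θ : ℝ)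
    (q : (𝕜 × E) × ((j : ι) → N j)) : (j : ι) → N j :=
  -dilate l (θ : 𝕜) (S.symm (H (q.1.1, (dilate l (θ : 𝕜)⁻¹ q.2, q.1.2))))

variable {S : ((j : ι) → N j) ≃L[𝕜] Y} {H : 𝕜 × (((j : ι) → N j) × E) → Y} {l : ι}
  {ρ κ A θ : ℝ} {b₀ : Y}

lemma dilatedMap_eq_iff (hθ : 0 < θ) (ε : 𝕜) (n : E) (ν : (j : ι) → N j) :
    dilatedMap S H l θ ((ε, n), dilate l (θ : 𝕜) ν) = dilate l (θ : 𝕜) ν ↔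
      S ν + H (ε, (ν, n)) = 0 := by
  have hθ' : (θ : 𝕜) ≠ 0 := by exact_mod_cast hθ.ne'
  rw [dilatedMap]
  simp only [dilate_inv_dilate l hθ']
  rw [← map_neg, ← map_neg, (Function.LeftInverse.injective (dilate_inv_dilate l hθ')).eq_iff,
    S.symm_apply_eq, eq_comm, eq_neg_iff_add_eq_zero]

/-- Smallness conditions under which `dilatedMap` is a contraction of a ball of radius `ρ`. -/
structure IsDilation (S : ((j : ι) → N j) ≃L[𝕜] Y) (l : ι) (ρ A : ℝ) (b₀ : Y) (θ : ℝ) : Prop where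
  pos : 0 < θ
  le_one : θ ≤ 1
  norm_le : ∀ v, ‖dilate l (θ : 𝕜) (S.symm v)‖ ≤ A * ‖v‖
  norm_le' : ‖dilate l (θ : 𝕜) (S.symm b₀)‖ ≤ ρ / 16

/-- The component with index `l` satisfies the bounds by assumption, and in the others a small `θ`
beats the uncontrolled norm of `S⁻¹`. Every smaller `θ` works too, which is needed for uniqueness.
-/
lemma exists_isDilation (hρ : 0 < ρ) (hA : 0 < A) (hSA : ∀ v, ‖S.symm v l‖ ≤ A * ‖v‖)
    (hb : ‖S.symm b₀ l‖ ≤ ρ / 16) :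
    ∃ θ₀ > 0, ∀ θ, 0 < θ → θ ≤ θ₀ → IsDilation S l ρ A b₀ θ := by
  set c := ‖(S.symm : Y →L[𝕜] (j : ι) → N j)‖
  have hc : 0 ≤ c := norm_nonneg _
  have hle : ∀ v j, ‖S.symm v j‖ ≤ c * ‖v‖ := fun v j =>
    (norm_le_pi_norm _ j).trans ((S.symm : Y →L[𝕜] (j : ι) → N j).le_opNorm v)
  refine ⟨min 1 (min (A / (c + 1)) (ρ / 16 / (c * ‖b₀‖ + 1))), by positivity, fun θ hθ h => ?_⟩
  have h1 : θ ≤ 1 := h.trans (min_le_left _ _)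
  have h2 : θ * (c + 1) ≤ A :=
    (le_div_iff₀ (by positivity)).1 (h.trans ((min_le_right _ _).trans (min_le_left _ _)))
  have h3 : θ * (c * ‖b₀‖ + 1) ≤ ρ / 16 :=
    (le_div_iff₀ (by positivity)).1 (h.trans ((min_le_right _ _).trans (min_le_right _ _)))
  have hnorm : ‖(θ : 𝕜)‖ = θ := by rw [RCLike.norm_ofReal, abs_of_pos hθ]
  refine ⟨hθ, h1, fun v => norm_dilate_le (by positivity) (hSA v) fun j => ?_,
    norm_dilate_le (by positivity) hb fun j => ?_⟩
  · rw [hnorm]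
    calc θ * ‖S.symm v j‖ ≤ θ * (c * ‖v‖) := by gcongr; exact hle v j
      _ = θ * c * ‖v‖ := by ring
      _ ≤ A * ‖v‖ := by gcongr; nlinarith
  · rw [hnorm]
    calc θ * ‖S.symm b₀ j‖ ≤ θ * (c * ‖b₀‖) := by gcongr; exact hle b₀ j
      _ ≤ ρ / 16 := by nlinarith

/-- Lipschitz estimate for `H(ε, ·)`: small in all directions except the component with
index `l` and the parameter, where the constant is `κ`. -/
def HasSmallLipschitz (H : 𝕜 × (((j : ι) → N j) × E) → Y) (l : ι) (ρ κ : ℝ) : Prop :=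
  ∀ R τ : ℝ, 0 < R → 0 < τ → ∀ᶠ ε in 𝓝 (0 : 𝕜), ∀ x x' : ((j : ι) → N j) × E,
    ‖x‖ ≤ R → ‖x'‖ ≤ R → ‖x.1 l‖ ≤ ρ → ‖x.2‖ ≤ ρ → ‖x'.1 l‖ ≤ ρ → ‖x'.2‖ ≤ ρ →
    ‖H (ε, x) - H (ε, x')‖ ≤ τ * ‖x - x'‖ + κ * (‖(x - x').1 l‖ + ‖(x - x').2‖)

lemma eventually_dilatedMap_contraction (hρ : 0 < ρ) (hρ1 : ρ ≤ 1) (hA : 0 < A) (hκ : 0 ≤ κ)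
    (hAκ : A * κ ≤ 1 / 16) (hθ : IsDilation S l ρ A b₀ θ)
    (hH : HasSmallLipschitz H l ρ κ)
    (hb : ∀ τ > 0, ∀ᶠ ε in 𝓝 (0 : 𝕜), ‖H (ε, 0) - b₀‖ ≤ τ) :
    ∀ᶠ ε in 𝓝 (0 : 𝕜), ∀ n : E, ‖n‖ ≤ ρ →
      (∀ μ μ', ‖μ‖ ≤ ρ → ‖μ'‖ ≤ ρ → ‖dilatedMap S H l θ ((ε, n), μ) -
        dilatedMap S H l θ ((ε, n), μ')‖ ≤ 1 / 2 * ‖μ - μ'‖) ∧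
      ‖dilatedMap S H l θ ((ε, n), 0)‖ ≤ ρ / 4 := by
  have hθ0 := hθ.pos
  have hθ1 := hθ.le_one
  -- This makes `A τ θ⁻¹ = ρ/32`, so undoing the dilation is harmless. The choice may depend on `θ`
  -- because `τ` is arbitrary in `HasSmallLipschitz`, at the price of a smaller `ε`.
  set τ := ρ * θ / (32 * A) with hτ_def
  have hτ : 0 < τ := by positivity
  have hAτ : A * τ = ρ * θ / 32 := by rw [hτ_def]; field_simp
  have hnorm : ‖(θ : 𝕜)⁻¹‖ = θ⁻¹ := by rw [norm_inv, RCLike.norm_ofReal, abs_of_pos hθ0]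
  have hinv : 1 ≤ θ⁻¹ := (one_le_inv₀ hθ0).2 hθ1
  have hdil : ∀ μ : (j : ι) → N j, ‖dilate l (θ : 𝕜)⁻¹ μ‖ ≤ θ⁻¹ * ‖μ‖ := fun μ => by
    refine norm_dilate_le (by positivity) ?_ fun j => ?_
    · exact (norm_le_pi_norm μ l).trans (le_mul_of_one_le_left (norm_nonneg _) hinv)
    · rw [hnorm]; gcongr; exact norm_le_pi_norm μ j
  filter_upwards [hH (θ⁻¹ * ρ) τ (by positivity) hτ, hb τ hτ] with ε hε hεb n hn
  have hR : ∀ μ : (j : ι) → N j, ‖μ‖ ≤ ρ → ‖(dilate l (θ : 𝕜)⁻¹ μ, n)‖ ≤ θ⁻¹ * ρ := fun μ hμ => by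
    refine max_le ((hdil μ).trans (by gcongr)) (hn.trans ?_)
    exact le_mul_of_one_le_left hρ.le hinv
  have hl : ∀ μ : (j : ι) → N j, ‖μ‖ ≤ ρ → ‖dilate l (θ : 𝕜)⁻¹ μ l‖ ≤ ρ := fun μ hμ => by
    rw [dilate_apply_self]; exact (norm_le_pi_norm μ l).trans hμ
  refine ⟨fun μ μ' hμ hμ' => ?_, ?_⟩
  · have h1 := hε _ _ (hR μ hμ) (hR μ' hμ') (hl μ hμ) hn (hl μ' hμ') hn
    simp only [Prod.mk_sub_mk, sub_self, ← map_sub, norm_zero, add_zero, Prod.norm_mk,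
      dilate_apply_self] at h1
    rw [max_eq_left (norm_nonneg _)] at h1
    have h2 := norm_le_pi_norm (μ - μ') l
    have h3 := hdil (μ - μ')
    rw [dilatedMap, dilatedMap, neg_sub_neg, norm_sub_rev, ← map_sub, ← map_sub]
    refine (hθ.norm_le _).trans ?_
    calc A * ‖H (ε, (dilate l (θ : 𝕜)⁻¹ μ, n)) - H (ε, (dilate l (θ : 𝕜)⁻¹ μ', n))‖
        ≤ A * (τ * (θ⁻¹ * ‖μ - μ'‖) + κ * ‖μ - μ'‖) := by
          gcongr
          refine h1.trans ?_
          gcongr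
      _ = (A * τ * θ⁻¹ + A * κ) * ‖μ - μ'‖ := by ring
      _ ≤ 1 / 2 * ‖μ - μ'‖ := by
          gcongr
          rw [hAτ, show ρ * θ / 32 * θ⁻¹ = ρ / 32 by field_simp]
          linarith
  · have h1 := hε (0, n) 0 (by simpa using hR 0 (by simpa using hρ.le)) (by simp; positivity)
      (by simpa using hρ.le) hn (by simpa using hρ.le) (by simpa using hρ.le)
    simp only [sub_zero, Prod.norm_mk, norm_zero, Pi.zero_apply, zero_add] at h1
    rw [max_eq_right (norm_nonneg _)] at h1
    have h2 : ‖H (ε, (0, n)) - b₀‖ ≤ 2 * τ + κ * ρ := by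
      calc ‖H (ε, (0, n)) - b₀‖ ≤ ‖H (ε, (0, n)) - H (ε, 0)‖ + ‖H (ε, 0) - b₀‖ :=
            norm_sub_le_norm_sub_add_norm_sub _ _ _
        _ ≤ (τ * ρ + κ * ρ) + τ := by
            gcongr
            refine h1.trans ?_
            gcongr
        _ ≤ 2 * τ + κ * ρ := by nlinarith
    rw [dilatedMap, norm_neg, map_zero]
    have h3 : H (ε, (0, n)) = (H (ε, (0, n)) - b₀) + b₀ := by abel
    simp only
    rw [h3, map_add, map_add]
    refine (norm_add_le _ _).trans ?_
    have h4 := (hθ.norm_le (H (ε, (0, n)) - b₀)).trans (mul_le_mul_of_nonneg_left h2 hA.le)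
    have h5 := hθ.norm_le'
    have h6 : A * (2 * τ + κ * ρ) = 2 * (A * τ) + A * κ * ρ := by ring
    rw [h6, hAτ] at h4
    have h7 : A * κ * ρ ≤ 1 / 16 * ρ := by gcongr
    have h8 : ρ * θ ≤ ρ := mul_le_of_le_one_right hρ.le hθ1
    linarith

/-- All small solutions of `S ν + H(ε, ν, n) = 0`, where `H` has a small Lipschitz constant. -/
lemma exists_solution_of_hasSmallLipschitz [∀ j, CompleteSpace (N j)] [CompleteSpace E]
    {m : WithTop ℕ∞} (hm : m ≠ 0) {η₀ : ℝ} (hη₀ : 0 < η₀)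
    (hsmooth : ContDiffOn 𝕜 m H (Metric.ball (0 : 𝕜) η₀ ×ˢ univ))
    (hρ : 0 < ρ) (hρ1 : ρ ≤ 1) (hA : 0 < A) (hκ : 0 ≤ κ) (hAκ : A * κ ≤ 1 / 16)
    (hSA : ∀ v, ‖S.symm v l‖ ≤ A * ‖v‖) (hb₀ : ‖S.symm b₀ l‖ ≤ ρ / 16)
    (hH : HasSmallLipschitz H l ρ κ)
    (hb : ∀ τ > 0, ∀ᶠ ε in 𝓝 (0 : 𝕜), ‖H (ε, 0) - b₀‖ ≤ τ) :
    ∃ η > 0, η ≤ η₀ ∧ ∃ f : 𝕜 × E → (j : ι) → N j,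
      ContDiffOn 𝕜 m f (Metric.ball (0 : 𝕜) η ×ˢ Metric.ball (0 : E) ρ) ∧
      (∀ ε n, ‖ε‖ < η → ‖n‖ < ρ → ‖f (ε, n) l‖ < ρ ∧ S (f (ε, n)) + H (ε, (f (ε, n), n)) = 0) ∧
      ∀ C : ℝ, ∃ η' > 0, η' ≤ η ∧ ∀ ε ν n, ‖ε‖ < η' → ‖n‖ < ρ → ‖ν l‖ < ρ → (∀ j, ‖ν j‖ ≤ C) →
        (S ν + H (ε, (ν, n)) = 0 ↔ ν = f (ε, n)) := by
  obtain ⟨θ, hθ0, hθ⟩ := exists_isDilation (b₀ := b₀) hρ hA hSA hb₀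
  have hev := fun θ' h h' => eventually_dilatedMap_contraction hρ hρ1 hA hκ hAκ (hθ θ' h h') hH hb
  obtain ⟨η₁, hη₁, hball⟩ := Metric.eventually_nhds_iff_ball.1 (hev θ hθ0 le_rfl)
  have hθ' : (θ : 𝕜) ≠ 0 := by exact_mod_cast hθ0.ne'
  set η := min η₀ η₁
  have hη : 0 < η := lt_min hη₀ hη₁
  have hΨ : ContDiffOn 𝕜 m (dilatedMap S H l θ)
      ((Metric.ball (0 : 𝕜) η ×ˢ Metric.ball (0 : E) ρ) ×ˢ univ) := by
    have h1 : ContDiff 𝕜 m fun q : (𝕜 × E) × ((j : ι) → N j) =>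
        (q.1.1, (dilate l (θ : 𝕜)⁻¹ q.2, q.1.2)) := by fun_prop
    have h2 := hsmooth.comp h1.contDiffOn (s := (Metric.ball (0 : 𝕜) η ×ˢ Metric.ball (0 : E) ρ) ×ˢ
      univ) fun q hq => ⟨Metric.ball_subset_ball (min_le_left _ _) hq.1.1, mem_univ _⟩
    exact ((dilate (N := N) l (θ : 𝕜)).contDiff.comp_contDiffOn
      (S.symm.contDiff.comp_contDiffOn h2)).neg
  have hmem : ∀ p ∈ Metric.ball (0 : 𝕜) η ×ˢ Metric.ball (0 : E) ρ,
      p.1 ∈ Metric.ball (0 : 𝕜) η₁ ∧ ‖p.2‖ ≤ ρ := fun p hp =>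
    ⟨Metric.ball_subset_ball (min_le_right _ _) hp.1, (mem_ball_zero_iff.1 hp.2).le⟩
  obtain ⟨g, hg, hgfix⟩ := exists_contDiffOn_fixedPoint hm
    (Metric.isOpen_ball.prod Metric.isOpen_ball) hΨ hρ
    (fun p hp => (hball p.1 (hmem p hp).1 p.2 (hmem p hp).2).1)
    (fun p hp => (hball p.1 (hmem p hp).1 p.2 (hmem p hp).2).2)
  have hsol : ∀ ε n, ‖ε‖ < η → ‖n‖ < ρ → ‖g (ε, n)‖ < ρ ∧
      S (dilate l (θ : 𝕜)⁻¹ (g (ε, n))) + H (ε, (dilate l (θ : 𝕜)⁻¹ (g (ε, n)), n)) = 0 := by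
    intro ε n hε hn
    obtain ⟨h1, h2, -⟩ := hgfix (ε, n) ⟨mem_ball_zero_iff.2 hε, mem_ball_zero_iff.2 hn⟩
    refine ⟨h1, (dilatedMap_eq_iff (l := l) hθ0 ε n _).1 ?_⟩
    rwa [dilate_dilate_inv l hθ']
  refine ⟨η, hη, min_le_left _ _, fun p => dilate l (θ : 𝕜)⁻¹ (g p),
    (dilate (N := N) l (θ : 𝕜)⁻¹).contDiff.comp_contDiffOn hg, fun ε n hε hn => ⟨?_, (hsol ε n hε hn).2⟩,
    fun C => ?_⟩
  · simp only [dilate_apply_self]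
    exact (norm_le_pi_norm _ l).trans_lt (hsol ε n hε hn).1
  · set t := min θ (ρ / (|C| + 1))
    have ht0 : 0 < t := lt_min hθ0 (by positivity)
    have htC : t * |C| ≤ ρ := by
      have : t * (|C| + 1) ≤ ρ := (le_div_iff₀ (by positivity)).1 (min_le_right _ _)
      nlinarith
    have hnorm : ‖(t : 𝕜)‖ = t := by rw [RCLike.norm_ofReal, abs_of_pos ht0]
    have hnorm' : ‖(θ : 𝕜)⁻¹‖ = θ⁻¹ := by rw [norm_inv, RCLike.norm_ofReal, abs_of_pos hθ0]
    obtain ⟨η₂, hη₂, hball₂⟩ := Metric.eventually_nhds_iff_ball.1 (hev t ht0 (min_le_left _ _))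
    refine ⟨min η η₂, lt_min hη hη₂, min_le_left _ _, fun ε ν n hε hn hνl hνC => ?_⟩
    have hεη : ‖ε‖ < η := hε.trans_le (min_le_left _ _)
    obtain ⟨hgρ, hgsol⟩ := hsol ε n hεη hn
    refine ⟨fun hν => ?_, fun h => h ▸ hgsol⟩
    have hcontr := (hball₂ ε (mem_ball_zero_iff.2 (hε.trans_le (min_le_right _ _))) n hn.le).1
    set ν' := dilate l (θ : 𝕜)⁻¹ (g (ε, n))
    have h1 : ‖dilate l (t : 𝕜) ν‖ ≤ ρ := norm_dilate_le hρ.le hνl.le fun j => by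
      rw [hnorm]
      calc t * ‖ν j‖ ≤ t * |C| := by gcongr; exact (hνC j).trans (le_abs_self C)
        _ ≤ ρ := htC
    have h2 : ‖dilate l (t : 𝕜) ν'‖ ≤ ρ := norm_dilate_le hρ.le
      (by simp only [ν', dilate_apply_self]; exact (norm_le_pi_norm _ l).trans hgρ.le) fun j => by
      have hj : ‖g (ε, n) j‖ ≤ ρ := (norm_le_pi_norm _ j).trans hgρ.le
      rw [hnorm]
      simp only [ν', dilate_apply]
      split_ifs
      · rw [one_smul]
        calc t * ‖g (ε, n) j‖ ≤ 1 * ρ := by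
              gcongr
              exact (min_le_left _ _).trans (hθ θ hθ0 le_rfl).le_one
          _ = ρ := one_mul ρ
      · rw [norm_smul, hnorm']
        calc t * (θ⁻¹ * ‖g (ε, n) j‖) ≤ θ * (θ⁻¹ * ρ) := by gcongr; exact min_le_left _ _
          _ = ρ := by field_simp
    have h3 := hcontr _ _ h1 h2
    rw [(dilatedMap_eq_iff (l := l) ht0 ε n ν).2 hν,
      (dilatedMap_eq_iff (l := l) ht0 ε n ν').2 hgsol] at h3
    have h4 : ‖dilate l (t : 𝕜) ν - dilate l (t : 𝕜) ν'‖ = 0 :=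
      le_antisymm (by linarith [norm_nonneg (dilate l (t : 𝕜) ν - dilate l (t : 𝕜) ν')])
        (norm_nonneg _)
    have ht' : (t : 𝕜) ≠ 0 := by exact_mod_cast ht0.ne'
    exact (Function.LeftInverse.injective (dilate_inv_dilate l ht'))
      (sub_eq_zero.1 (norm_eq_zero.1 h4))

end DilatedFixedPoint

/-! ### Division by powers of `ε` -/

section Quotient

open Set

variable {𝕜 : Type*} [RCLike 𝕜] {E : Type*} [NormedAddCommGroup E] [NormedSpace 𝕜 E]
  {Y : Type*} [NormedAddCommGroup Y] [NormedSpace 𝕜 Y] [CompleteSpace Y]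

/-- A smooth map which is pointwise `O(ε^q)` is divisible by `ε^q`. -/
lemma exists_eq_pow_smul {n : ℕ∞} {q : ℕ} {r : ℝ} (hr : 0 < r) {g : 𝕜 × E → Y}
    (hg : ContDiffOn 𝕜 ((n + q : ℕ∞) : WithTop ℕ∞) g (Metric.ball (0 : 𝕜) r ×ˢ univ))
    (hO : ∀ x, (fun ε => g (ε, x)) =O[𝓝 0] fun ε : 𝕜 => ε ^ q) :
    ∃ F : 𝕜 × E → Y, ContDiffOn 𝕜 n F (Metric.ball (0 : 𝕜) r ×ˢ univ) ∧
      ∀ ε ∈ Metric.ball (0 : 𝕜) r, ∀ x, g (ε, x) = ε ^ q • F (ε, x) := by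
  obtain ⟨c, F, hF, hgF⟩ := exists_taylor_expansion q hg
  refine ⟨F, hF, fun ε hε x => ?_⟩
  rw [hgF ε hε x, add_eq_right]
  cases q with
  | zero => simp
  | succ q =>
    have hFx : (fun ε => F (ε, x)) =O[𝓝 0] fun _ => (1 : 𝕜) := by
      have h1 : ContinuousAt F (0, x) := hF.continuousOn.continuousAt
        ((Metric.isOpen_ball.prod isOpen_univ).mem_nhds ⟨Metric.mem_ball_self hr, mem_univ _⟩)
      have h2 : Tendsto (fun ε : 𝕜 => F (ε, x)) (𝓝 0) (𝓝 (F (0, x))) :=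
        h1.tendsto.comp ((Continuous.prodMk_left x).tendsto 0)
      exact h2.isBigO_one 𝕜
    -- The Taylor polynomial of degree `q` is a difference of two `O(ε^(q+1))` terms, so all its
    -- coefficients vanish.
    have h3 : polyCurve (fun j => c j x) q =O[𝓝 0] fun ε : 𝕜 => ε ^ (q + 1) := by
      refine ((hO x).sub (isBigO_pow_smul_of_one (q + 1) hFx)).congr' ?_ EventuallyEq.rfl
      filter_upwards [Metric.ball_mem_nhds (0 : 𝕜) hr] with ε hε
      rw [hgF ε hε x, add_sub_cancel_right]
      rfl
    have h4 := eq_zero_of_polyCurve_isBigO (h3.mono nhdsWithin_le_nhds)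
    exact Finset.sum_eq_zero fun j hj => by
      rw [h4 j (Nat.lt_succ_iff.1 (Finset.mem_range.1 hj)), smul_zero]

variable {B : Type*} [NormedAddCommGroup B] [NormedSpace 𝕜 B]

lemma exists_hasExpansion_linFamily {G : B → Y} {z : 𝕜 → B} {k : ℕ} {r : ℝ} (hr : 0 < r)
    (hG : ContDiff 𝕜 (k + 2 : ℕ) G) (hz : ContDiffOn 𝕜 (k + 1 : ℕ) z (Metric.ball 0 r)) :
    ∃ a, HasExpansion (linFamily G z) a k := by
  have hG' : ContDiff 𝕜 (k + 1 : ℕ) (fderiv 𝕜 G) := hG.fderiv_right (by norm_cast)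
  have h1 : ContDiffOn 𝕜 (((0 : ℕ∞) + (k + 1 : ℕ) : ℕ∞) : WithTop ℕ∞)
      (fun q : 𝕜 × 𝕜 => linFamily G z q.1) (Metric.ball (0 : 𝕜) r ×ˢ univ) := by
    rw [zero_add]
    exact hG'.comp_contDiffOn (hz.comp contDiff_fst.contDiffOn fun q hq => hq.1)
  obtain ⟨c, R, hR, hL⟩ := exists_taylor_expansion (k + 1) h1
  refine ⟨fun j => c j 0, HasExpansion.of_remainder (R := fun ε => R (ε, 0)) ?_ ?_⟩
  · have h1 : ContinuousAt R (0, 0) := hR.continuousOn.continuousAt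
      ((Metric.isOpen_ball.prod isOpen_univ).mem_nhds ⟨Metric.mem_ball_self hr, mem_univ _⟩)
    have h2 : Tendsto (fun ε : 𝕜 => R (ε, 0)) (𝓝 0) (𝓝 (R (0, 0))) :=
      h1.tendsto.comp ((Continuous.prodMk_left (0 : 𝕜)).tendsto 0)
    exact h2.isBigO_one 𝕜
  · filter_upwards [Metric.ball_mem_nhds (0 : 𝕜) hr] with ε hε
    exact hL ε hε 0

end Quotient


/-! ### Estimates in the generalized cone -/

section Cone

open Set

variable {𝕜 : Type*} [RCLike 𝕜]
  {B : Type*} [NormedAddCommGroup B] [NormedSpace 𝕜 B]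
  {B' : Type*} [NormedAddCommGroup B'] [NormedSpace 𝕜 B']
  {k : ℕ} {N : Fin (k + 1) → Type*} [∀ j, NormedAddCommGroup (N j)] [∀ j, NormedSpace 𝕜 (N j)]
  {E : Type*} [NormedAddCommGroup E] [NormedSpace 𝕜 E]

lemma isBigO_clm_comp_right {F H : Type*}
    [NormedAddCommGroup F] [NormedSpace 𝕜 F] [NormedAddCommGroup H] [NormedSpace 𝕜 H]
    {f : 𝕜 → E →L[𝕜] F} {g : 𝕜 → 𝕜} {l : Filter 𝕜} (hf : f =O[l] g) (J : H →L[𝕜] E) :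
    (fun ε => f ε ∘L J) =O[l] g :=
  (((ContinuousLinearMap.compL 𝕜 H E F).flip J).isBigO_comp f l).trans hf

/-- The vector `ε^k n₀ + ⋯ + ε n_{k-1} + n_k + n`, where `n_j` and `n` are mapped into `B`. -/
def coneVec (J : (j : Fin (k + 1)) → N j →L[𝕜] B) (J' : E →L[𝕜] B) (ε : 𝕜) :
    ((j : Fin (k + 1)) → N j) × E →L[𝕜] B :=
  ∑ j : Fin (k + 1), ε ^ (k - (j : ℕ)) • (J j ∘L
    ContinuousLinearMap.proj (R := 𝕜) (φ := N) j ∘L ContinuousLinearMap.fst 𝕜 _ _) +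
    J' ∘L ContinuousLinearMap.snd 𝕜 _ _

variable {J : (j : Fin (k + 1)) → N j →L[𝕜] B} {J' : E →L[𝕜] B} {p : 𝕜 → B →L[𝕜] B}

lemma coneVec_apply (ε : 𝕜) (x : ((j : Fin (k + 1)) → N j) × E) :
    coneVec J J' ε x = ∑ j : Fin (k + 1), ε ^ (k - (j : ℕ)) • J j (x.1 j) + J' x.2 := by
  simp [coneVec]

/-- At `ε = 0` only `n_{k+1}ᶜ` and `n_{k+1}` survive. These are the directions in which the
Lipschitz constant need not tend to `0`. -/
lemma norm_coneVec_zero_apply_le (hJ : ∀ j x, ‖J j x‖ ≤ ‖x‖) (hJ' : ∀ x, ‖J' x‖ ≤ ‖x‖)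
    (x : ((j : Fin (k + 1)) → N j) × E) :
    ‖coneVec J J' (0 : 𝕜) x‖ ≤ ‖x.1 (Fin.last k)‖ + ‖x.2‖ := by
  rw [coneVec_apply, Finset.sum_eq_single (Fin.last k)]
  · simpa using (norm_add_le _ _).trans (add_le_add (hJ _ _) (hJ' _))
  · intro j _ hj
    have : (j : ℕ) < k := lt_of_le_of_ne (Nat.lt_succ_iff.1 j.2) fun h => hj (Fin.ext h)
    rw [zero_pow (by omega), zero_smul]
  · simp

lemma contDiff_coneVec {n : WithTop ℕ∞} : ContDiff 𝕜 n (coneVec (𝕜 := 𝕜) J J') :=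
  (ContDiff.sum fun _ _ => (contDiff_id.pow _).smul contDiff_const).add contDiff_const

lemma comp_coneVec_isBigO (hp : ContDiff 𝕜 1 p) (hp0 : p 0 = ContinuousLinearMap.id 𝕜 B) :
    (fun ε => p ε ∘L coneVec J J' ε - coneVec J J' 0) =O[𝓝 0] fun ε : 𝕜 => ε := by
  have h1 : ContDiff 𝕜 1 fun ε => p ε ∘L coneVec J J' ε := hp.clm_comp contDiff_coneVec
  have h2 := ((h1.differentiable one_ne_zero) 0).hasFDerivAt.isBigO_sub
  simpa [hp0] using h2

/-- The weight `ε^(k-j)` complements the order `ε^j` of the `j`-th chain, so all leading terms meet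
at order `k` and add up to `S`. -/
lemma comp_comp_coneVec_isBigO {L : 𝕜 → B →L[𝕜] B'} {σ : (j : Fin (k + 1)) → N j →L[𝕜] B'}
    {S : ((j : Fin (k + 1)) → N j) →L[𝕜] B'} (hS : ∀ ν, S ν = ∑ j, σ j (ν j))
    (h1 : ∀ j : Fin (k + 1), (fun ε => L ε ∘L p ε ∘L J j - ε ^ (j : ℕ) • σ j) =O[𝓝 0]
      fun ε : 𝕜 => ε ^ ((j : ℕ) + 1))
    (h2 : (fun ε => L ε ∘L p ε ∘L J') =O[𝓝 0] fun ε : 𝕜 => ε ^ (k + 1)) :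
    (fun ε => L ε ∘L p ε ∘L coneVec J J' ε - ε ^ k •
      (S ∘L ContinuousLinearMap.fst 𝕜 ((j : Fin (k + 1)) → N j) E)) =O[𝓝 0]
      fun ε : 𝕜 => ε ^ (k + 1) := by
  have h3 : ∀ j : Fin (k + 1), (fun ε : 𝕜 => ε ^ (k - (j : ℕ)) •
      ((L ε ∘L p ε ∘L J j - ε ^ (j : ℕ) • σ j) ∘L
      (ContinuousLinearMap.proj (R := 𝕜) (φ := N) j ∘L
        ContinuousLinearMap.fst 𝕜 ((j : Fin (k + 1)) → N j) E))) =O[𝓝 0]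
      fun ε : 𝕜 => ε ^ (k + 1) := by
    intro j
    have := isBigO_pow_smul (k - (j : ℕ)) (isBigO_clm_comp_right (h1 j)
      (ContinuousLinearMap.proj (R := 𝕜) (φ := N) j ∘L
        ContinuousLinearMap.fst 𝕜 ((j : Fin (k + 1)) → N j) E))
    rwa [show k - (j : ℕ) + ((j : ℕ) + 1) = k + 1 by omega] at this
  have h4 := isBigO_clm_comp_right h2 (ContinuousLinearMap.snd 𝕜 ((j : Fin (k + 1)) → N j) E)
  refine ((IsBigO.sum (s := Finset.univ) fun j _ => h3 j).add h4).congr_left fun ε => ?_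
  refine ContinuousLinearMap.ext fun x => ?_
  have h5 : ∀ j : Fin (k + 1), ε ^ (k - (j : ℕ)) • ε ^ (j : ℕ) • σ j (x.1 j)
      = ε ^ k • σ j (x.1 j) := fun j => by
    rw [smul_smul, ← pow_add, Nat.sub_add_cancel (Nat.lt_succ_iff.1 j.2)]
  simp only [Finset.sum_apply, add_apply, sum_apply, sub_apply, smul_apply, ContinuousLinearMap.comp_apply,
    ContinuousLinearMap.proj_apply, ContinuousLinearMap.coe_fst', ContinuousLinearMap.coe_snd',
    coneVec_apply, hS, map_add, map_sum, map_smul, smul_sub, Finset.sum_sub_distrib,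
    Finset.smul_sum, h5]
  abel

/-- The Lipschitz estimate for the remainder `G(z(ε) + ε^s p(ε) w) - ε^(i + 2 s) S ν`, where
`w = ε^k ν₀ + ⋯ + ν_k + n`. -/
lemma eventually_norm_remainder_sub_le {G : B → B'} {z : 𝕜 → B} {i s : ℕ} (hs : 1 ≤ s)
    (hk : i + s = k) (hG : ContDiff 𝕜 (i + 2 : ℕ) G) {M M' r₀ : ℝ} (hr₀ : 0 < r₀) (hM : 0 ≤ M)
    (hM' : 0 ≤ M') (hG2 : ∀ v, ‖v‖ < r₀ → ‖fderiv 𝕜 (fderiv 𝕜 G) v‖ ≤ M * ‖v‖ ^ i)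
    (hz : ∀ᶠ ε in 𝓝 0, ‖z ε‖ ≤ M' * ‖ε‖)
    (hJ : ∀ j x, ‖J j x‖ ≤ ‖x‖) (hJ' : ∀ x, ‖J' x‖ ≤ ‖x‖)
    (hp : ContDiff 𝕜 1 p) (hp0 : p 0 = ContinuousLinearMap.id 𝕜 B)
    {σ : (j : Fin (k + 1)) → N j →L[𝕜] B'} {S : ((j : Fin (k + 1)) → N j) →L[𝕜] B'}
    (hS : ∀ ν, S ν = ∑ j, σ j (ν j))
    (h1 : ∀ j : Fin (k + 1), (fun ε => linFamily G z ε ∘L p ε ∘L J j - ε ^ (j : ℕ) • σ j) =O[𝓝 0]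
      fun ε : 𝕜 => ε ^ ((j : ℕ) + 1))
    (h2 : (fun ε => linFamily G z ε ∘L p ε ∘L J') =O[𝓝 0] fun ε : 𝕜 => ε ^ (k + 1))
    {ρ R τ : ℝ} (hρ : 0 < ρ) (hτ : 0 < τ) :
    ∀ᶠ ε in 𝓝 (0 : 𝕜), ∀ x x' : ((j : Fin (k + 1)) → N j) × E, ‖x‖ ≤ R → ‖x'‖ ≤ R →
      ‖x.1 (Fin.last k)‖ ≤ ρ → ‖x.2‖ ≤ ρ → ‖x'.1 (Fin.last k)‖ ≤ ρ → ‖x'.2‖ ≤ ρ →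
      ‖(G (z ε + ε ^ s • p ε (coneVec J J' ε x)) - ε ^ (i + 2 * s) • S x.1) -
        (G (z ε + ε ^ s • p ε (coneVec J J' ε x')) - ε ^ (i + 2 * s) • S x'.1)‖ ≤
      ‖ε‖ ^ (i + 2 * s) * (τ * ‖x - x'‖ + M * (M' + 3 * ρ) ^ i * (3 * ρ) *
        (‖(x - x').1 (Fin.last k)‖ + ‖(x - x').2‖)) := by
  set c := M * (M' + 3 * ρ) ^ i * (3 * ρ)
  have hc : 0 ≤ c := by positivity
  obtain ⟨K₁, hK₁, hO₁⟩ := (comp_comp_coneVec_isBigO hS h1 h2).exists_pos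
  obtain ⟨K₂, hK₂, hO₂⟩ := (comp_coneVec_isBigO (J := J) (J' := J') hp hp0).exists_pos
  have hsmall : ∀ K t : ℝ, 0 < t → ∀ᶠ ε in 𝓝 (0 : 𝕜), K * ‖ε‖ ≤ t := fun K t ht => by
    have h : Continuous fun ε : 𝕜 => K * ‖ε‖ := by fun_prop
    have h' : Tendsto (fun ε : 𝕜 => K * ‖ε‖) (𝓝 0) (𝓝 0) := by
      simpa only [norm_zero, mul_zero] using h.tendsto 0
    exact h'.eventually (ge_mem_nhds ht)
  filter_upwards [hO₁.bound, hO₂.bound, hsmall (K₁ + c * K₂) τ hτ, hsmall (K₂ * R) ρ hρ,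
    exists_nonlinear_lipschitz hs hG hr₀ hM hM' hG2 hz (r := 3 * ρ) (by positivity)]
    with ε e1 e2 e3 e4 e5 x x' hx hx' hx1 hx2 hx1' hx2'
  have hlin : ∀ v : ((j : Fin (k + 1)) → N j) × E,
      ‖linFamily G z ε (p ε (coneVec J J' ε v)) - ε ^ k • S v.1‖ ≤
        K₁ * ‖ε‖ ^ (k + 1) * ‖v‖ := fun v => by
    rw [norm_pow] at e1
    exact ContinuousLinearMap.le_of_opNorm_le _ e1 v
  have hvec : ∀ v : ((j : Fin (k + 1)) → N j) × E,
      ‖p ε (coneVec J J' ε v)‖ ≤ ‖v.1 (Fin.last k)‖ + ‖v.2‖ + K₂ * ‖ε‖ * ‖v‖ := fun v => by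
    have h3 : ‖p ε (coneVec J J' ε v) - coneVec J J' 0 v‖ ≤ K₂ * ‖ε‖ * ‖v‖ :=
      ContinuousLinearMap.le_of_opNorm_le _ e2 v
    have h4 := norm_coneVec_zero_apply_le hJ hJ' v
    have h5 := norm_le_norm_add_norm_sub' (p ε (coneVec J J' ε v)) (coneVec J J' 0 v)
    linarith
  -- The radius `3ρ` consists of `ρ` for each of the two leading components and `ρ` for the `O(ε)`
  -- remainder, small by the choice of `ε` although `R` may be large.
  have hbound : ∀ v : ((j : Fin (k + 1)) → N j) × E, ‖v‖ ≤ R → ‖v.1 (Fin.last k)‖ ≤ ρ →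
      ‖v.2‖ ≤ ρ → ‖p ε (coneVec J J' ε v)‖ ≤ 3 * ρ := fun v hv hv1 hv2 => by
    have h3 : K₂ * ‖ε‖ * ‖v‖ ≤ K₂ * R * ‖ε‖ := by
      rw [mul_right_comm]
      gcongr
    linarith [hvec v]
  set y := p ε (coneVec J J' ε x) with hy
  set y' := p ε (coneVec J J' ε x') with hy'
  have hyy' : y - y' = p ε (coneVec J J' ε (x - x')) := by rw [map_sub, map_sub]
  have h3 := e5 y y' (hbound x hx hx1 hx2) (hbound x' hx' hx1' hx2')
  have h4 : ‖ε ^ s • (linFamily G z ε (y - y') - ε ^ k • S (x - x').1)‖ ≤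
      ‖ε‖ ^ (i + 2 * s) * (K₁ * ‖ε‖ * ‖x - x'‖) := by
    rw [norm_smul, norm_pow, hyy']
    refine (mul_le_mul_of_nonneg_left (hlin (x - x')) (by positivity)).trans (le_of_eq ?_)
    have h : ‖ε‖ ^ s * ‖ε‖ ^ (k + 1) = ‖ε‖ ^ (i + 2 * s) * ‖ε‖ := by
      rw [← pow_add, ← pow_succ]
      congr 1
      omega
    linear_combination K₁ * ‖x - x'‖ * h
  -- The nonlinear part is separated from the chain error; `i + 2s = s + k` lets `ε^(i+2s) S` be
  -- compared with `ε^s L p`.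
  have hsplit : (G (z ε + ε ^ s • y) - ε ^ (i + 2 * s) • S x.1) -
      (G (z ε + ε ^ s • y') - ε ^ (i + 2 * s) • S x'.1)
      = ((G (z ε + ε ^ s • y) - ε ^ s • fderiv 𝕜 G (z ε) y) -
        (G (z ε + ε ^ s • y') - ε ^ s • fderiv 𝕜 G (z ε) y')) +
        ε ^ s • (linFamily G z ε (y - y') - ε ^ k • S (x - x').1) := by
    rw [show i + 2 * s = s + k by omega, pow_add]
    simp only [linFamily, Prod.fst_sub, map_sub, smul_sub, mul_smul]
    abel
  rw [hsplit]
  refine (norm_add_le _ _).trans ((add_le_add h3 h4).trans ?_)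
  rw [mul_assoc, ← mul_add]
  refine mul_le_mul_of_nonneg_left ?_ (by positivity)
  have h5 := hvec (x - x')
  rw [← hyy'] at h5
  have h6 := mul_le_mul_of_nonneg_left h5 hc
  have h7 := mul_le_mul_of_nonneg_right e3 (norm_nonneg (x - x'))
  have h8 : c * (‖(x - x').1 (Fin.last k)‖ + ‖(x - x').2‖ + K₂ * ‖ε‖ * ‖x - x'‖)
      + K₁ * ‖ε‖ * ‖x - x'‖ = (K₁ + c * K₂) * ‖ε‖ * ‖x - x'‖
      + c * (‖(x - x').1 (Fin.last k)‖ + ‖(x - x').2‖) := by ring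
  linarith

end Cone

/-! ### Solving the divided equation -/

section ConeSolutions

open Set

variable {𝕜 : Type*} [RCLike 𝕜]
  {B : Type*} [NormedAddCommGroup B] [NormedSpace 𝕜 B]
  {B' : Type*} [NormedAddCommGroup B'] [NormedSpace 𝕜 B']
  {k : ℕ} {N : Fin (k + 1) → Type*} [∀ j, NormedAddCommGroup (N j)] [∀ j, NormedSpace 𝕜 (N j)]
  {E : Type*} [NormedAddCommGroup E] [NormedSpace 𝕜 E]
  {J : (j : Fin (k + 1)) → N j →L[𝕜] B} {J' : E →L[𝕜] B} {p : 𝕜 → B →L[𝕜] B}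

lemma contDiffOn_comp_cone {n : WithTop ℕ∞} {G : B → B'} (hG : ContDiff 𝕜 n G) {z : 𝕜 → B}
    {V : Set 𝕜} (hz : ContDiffOn 𝕜 n z V) (hp : ContDiff 𝕜 n p) (s : ℕ) :
    ContDiffOn 𝕜 n (fun q : 𝕜 × (((j : Fin (k + 1)) → N j) × E) =>
      G (z q.1 + q.1 ^ s • p q.1 (coneVec J J' q.1 q.2))) (V ×ˢ univ) := by
  refine hG.comp_contDiffOn ((hz.comp contDiff_fst.contDiffOn fun q hq => hq.1).add ?_)
  have h1 : ContDiff 𝕜 n fun q : 𝕜 × (((j : Fin (k + 1)) → N j) × E) =>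
      coneVec J J' q.1 q.2 := (contDiff_coneVec.comp contDiff_fst).clm_apply contDiff_snd
  exact ((contDiff_fst.pow s).smul ((hp.comp contDiff_fst).clm_apply h1)).contDiffOn

/-- The solutions of `G = 0` in a generalized cone around an approximate solution curve. -/
theorem exists_cone_solutions [CompleteSpace B'] [∀ j, CompleteSpace (N j)]
    [CompleteSpace E] {i s : ℕ} (hs : 1 ≤ s) (hk : i + s = k) {m : ℕ∞} (hm : m ≠ 0)
    {G : B → B'} (hG : ContDiff 𝕜 ((m + (i + 2 * s : ℕ) : ℕ∞) : WithTop ℕ∞) G)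
    {z : 𝕜 → B} {η₀ : ℝ} (hη₀ : 0 < η₀)
    (hz : ContDiffOn 𝕜 ((m + (i + 2 * s : ℕ) : ℕ∞) : WithTop ℕ∞) z (Metric.ball 0 η₀))
    {b : 𝕜 → B'} (hb : ContinuousAt b 0)
    (hGz : ∀ ε ∈ Metric.ball (0 : 𝕜) η₀, G (z ε) = ε ^ (i + 2 * s) • b ε)
    {M M' r₀ : ℝ} (hr₀ : 0 < r₀) (hM : 0 ≤ M) (hM' : 0 ≤ M')
    (hG2 : ∀ v, ‖v‖ < r₀ → ‖fderiv 𝕜 (fderiv 𝕜 G) v‖ ≤ M * ‖v‖ ^ i)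
    (hzM' : ∀ᶠ ε in 𝓝 0, ‖z ε‖ ≤ M' * ‖ε‖)
    (hJ : ∀ j x, ‖J j x‖ ≤ ‖x‖) (hJ' : ∀ x, ‖J' x‖ ≤ ‖x‖)
    (hp : ∀ n : WithTop ℕ∞, ContDiff 𝕜 n p) (hp0 : p 0 = ContinuousLinearMap.id 𝕜 B)
    {σ : (j : Fin (k + 1)) → N j →L[𝕜] B'} {S : ((j : Fin (k + 1)) → N j) ≃L[𝕜] B'}
    (hS : ∀ ν, S ν = ∑ j, σ j (ν j))
    (h1 : ∀ j : Fin (k + 1), (fun ε => linFamily G z ε ∘L p ε ∘L J j - ε ^ (j : ℕ) • σ j) =O[𝓝 0]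
      fun ε : 𝕜 => ε ^ ((j : ℕ) + 1))
    (h2 : (fun ε => linFamily G z ε ∘L p ε ∘L J') =O[𝓝 0] fun ε : 𝕜 => ε ^ (k + 1))
    {ρ A : ℝ} (hρ : 0 < ρ) (hρ1 : ρ ≤ 1) (hA : 0 < A)
    (hAM : A * (M * (M' + 3 * ρ) ^ i * (3 * ρ)) ≤ 1 / 16)
    (hSA : ∀ v, ‖S.symm v (Fin.last k)‖ ≤ A * ‖v‖)
    (hb₀ : ‖S.symm (b 0) (Fin.last k)‖ ≤ ρ / 16) :
    ∃ η > 0, η ≤ η₀ ∧ ∃ f : 𝕜 × E → (j : Fin (k + 1)) → N j,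
      ContDiffOn 𝕜 m f (Metric.ball (0 : 𝕜) η ×ˢ Metric.ball (0 : E) ρ) ∧
      (∀ ε n, ‖ε‖ < η → ‖n‖ < ρ → ‖f (ε, n) (Fin.last k)‖ < ρ ∧
        G (z ε + ε ^ s • p ε (coneVec J J' ε (f (ε, n), n))) = 0) ∧
      ∀ C : ℝ, ∃ η' > 0, η' ≤ η ∧ ∀ ε ν n, ε ≠ 0 → ‖ε‖ < η' → ‖n‖ < ρ → ‖ν (Fin.last k)‖ < ρ →
        (∀ j, ‖ν j‖ ≤ C) →
        (G (z ε + ε ^ s • p ε (coneVec J J' ε (ν, n))) = 0 ↔ ν = f (ε, n)) := by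
  set q := i + 2 * s with hq
  let g : 𝕜 × (((j : Fin (k + 1)) → N j) × E) → B' := fun y =>
    G (z y.1 + y.1 ^ s • p y.1 (coneVec J J' y.1 y.2))
  have hgdef : ∀ ε x, g (ε, x) = G (z ε + ε ^ s • p ε (coneVec J J' ε x)) := fun _ _ => rfl
  have hg0 : ∀ ε, g (ε, 0) = G (z ε) := fun ε => by simp [hgdef]
  have hmq : ((i + 2 : ℕ) : WithTop ℕ∞) ≤ ((m + q : ℕ∞) : WithTop ℕ∞) := by
    have : ((i + 2 : ℕ) : ℕ∞) ≤ m + q :=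
      (Nat.cast_le.2 (by omega : i + 2 ≤ q)).trans le_add_self
    exact WithTop.coe_le_coe.2 this
  have hest : ∀ {ρ R τ : ℝ}, 0 < ρ → 0 < τ →
      ∀ᶠ ε in 𝓝 (0 : 𝕜), ∀ x x' : ((j : Fin (k + 1)) → N j) × E, ‖x‖ ≤ R → ‖x'‖ ≤ R →
      ‖x.1 (Fin.last k)‖ ≤ ρ → ‖x.2‖ ≤ ρ → ‖x'.1 (Fin.last k)‖ ≤ ρ → ‖x'.2‖ ≤ ρ →
      ‖(g (ε, x) - ε ^ q • S x.1) - (g (ε, x') - ε ^ q • S x'.1)‖ ≤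
      ‖ε‖ ^ q * (τ * ‖x - x'‖ + M * (M' + 3 * ρ) ^ i * (3 * ρ) *
        (‖(x - x').1 (Fin.last k)‖ + ‖(x - x').2‖)) := fun hρ hτ =>
    eventually_norm_remainder_sub_le (S := (S : _ →L[𝕜] B')) hs hk (hG.of_le hmq) hr₀ hM hM' hG2
      hzM' hJ hJ' (hp 1) hp0 hS h1 h2 hρ hτ
  -- The Lipschitz estimate against `x = 0`, where `G[z(ε)] = ε^q b(ε)`, gives the order `ε^q` for
  -- every fixed `x`, with a radius adapted to `x`.
  have hgO : ∀ x, (fun ε => g (ε, x)) =O[𝓝 0] fun ε : 𝕜 => ε ^ q := by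
    intro x
    have e1 : (fun ε : 𝕜 => ε ^ q • b ε) =O[𝓝 0] fun ε : 𝕜 => ε ^ q :=
      isBigO_pow_smul_of_one q (hb.tendsto.isBigO_one 𝕜)
    have e2 : (fun ε : 𝕜 => (g (ε, x) - ε ^ q • S x.1) - ε ^ q • b ε) =O[𝓝 0]
        fun ε : 𝕜 => ε ^ q := by
      refine IsBigO.of_bound (1 * ‖x‖ + M * (M' + 3 * (‖x‖ + 1)) ^ i * (3 * (‖x‖ + 1)) *
        (‖x.1 (Fin.last k)‖ + ‖x.2‖)) ?_
      filter_upwards [hest (ρ := ‖x‖ + 1) (R := ‖x‖) (τ := 1) (by positivity) one_pos,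
        Metric.ball_mem_nhds (0 : 𝕜) hη₀] with ε hε hεη
      have h3 := hε x 0 le_rfl (by simp)
        (((norm_le_pi_norm x.1 _).trans (norm_fst_le x)).trans (by linarith))
        ((norm_snd_le x).trans (by linarith)) (by simp; positivity) (by simp; positivity)
      rw [hg0, hGz ε hεη] at h3
      simp only [Prod.fst_zero, map_zero, smul_zero, sub_zero] at h3
      rw [mul_comm, norm_pow]
      exact h3
    refine ((e2.add e1).add (isBigO_pow_smul_const q (S x.1))).congr_left fun ε => ?_
    abel
  obtain ⟨F, hF, hgF⟩ := exists_eq_pow_smul hη₀ (contDiffOn_comp_cone hG hz (hp _) s) hgO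
  let H : 𝕜 × (((j : Fin (k + 1)) → N j) × E) → B' := fun y => F y - S y.2.1
  have hH : ContDiffOn 𝕜 m H (Metric.ball (0 : 𝕜) η₀ ×ˢ univ) := by
    have h3 : ContDiff 𝕜 m fun y : 𝕜 × (((j : Fin (k + 1)) → N j) × E) => S y.2.1 :=
      S.contDiff.comp (contDiff_fst.comp contDiff_snd)
    exact hF.sub h3.contDiffOn
  have hHg : ∀ ε ∈ Metric.ball (0 : 𝕜) η₀, ∀ x, ε ^ q • H (ε, x) = g (ε, x) - ε ^ q • S x.1 :=
    fun ε hε x => by rw [hgdef, hgF ε hε x, smul_sub]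
  have hHcont : ∀ x, ContinuousAt (fun ε => H (ε, x)) 0 := fun x =>
    ContinuousAt.comp (g := H) (f := fun ε => (ε, x)) (hH.continuousOn.continuousAt
      ((Metric.isOpen_ball.prod isOpen_univ).mem_nhds ⟨Metric.mem_ball_self hη₀, mem_univ _⟩))
      (Continuous.prodMk_left x).continuousAt
  have hH0 : ∀ ε ∈ Metric.ball (0 : 𝕜) η₀, ε ≠ 0 → H (ε, 0) = b ε := fun ε hε hε0 => by
    have h3 := hHg ε hε 0
    rw [hg0, hGz ε hε] at h3
    simpa [hε0] using h3
  -- At `ε = 0` division by `ε^q` says nothing; the value is recovered as a limit, and the Lipschitz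
  -- estimate for `H` below is extended to `ε = 0` likewise.
  have hHb : H (0, 0) = b 0 := by
    have h3 : Tendsto (fun ε => H (ε, 0)) (𝓝[≠] 0) (𝓝 (b 0)) := by
      refine (hb.tendsto.mono_left nhdsWithin_le_nhds).congr' ?_
      filter_upwards [self_mem_nhdsWithin,
        mem_nhdsWithin_of_mem_nhds (Metric.ball_mem_nhds (0 : 𝕜) hη₀)] with ε hε hεη
      exact (hH0 ε hεη hε).symm
    exact tendsto_nhds_unique ((hHcont 0).tendsto.mono_left nhdsWithin_le_nhds) h3
  have hHlip : HasSmallLipschitz H (Fin.last k) ρ (M * (M' + 3 * ρ) ^ i * (3 * ρ)) := by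
    intro R τ _ hτ
    have hne : ∀ᶠ ε in 𝓝 (0 : 𝕜), ε ≠ 0 → ∀ x x' : ((j : Fin (k + 1)) → N j) × E,
        ‖x‖ ≤ R → ‖x'‖ ≤ R → ‖x.1 (Fin.last k)‖ ≤ ρ → ‖x.2‖ ≤ ρ → ‖x'.1 (Fin.last k)‖ ≤ ρ →
        ‖x'.2‖ ≤ ρ → ‖H (ε, x) - H (ε, x')‖ ≤ τ * ‖x - x'‖ + M * (M' + 3 * ρ) ^ i * (3 * ρ) *
          (‖(x - x').1 (Fin.last k)‖ + ‖(x - x').2‖) := by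
      filter_upwards [hest (R := R) hρ hτ, Metric.ball_mem_nhds (0 : 𝕜) hη₀] with ε hε hεη hε0
        x x' hx hx' hx1 hx2 hx1' hx2'
      have h3 := hε x x' hx hx' hx1 hx2 hx1' hx2'
      rw [← hHg ε hεη, ← hHg ε hεη, ← smul_sub, norm_smul, norm_pow] at h3
      exact le_of_mul_le_mul_left h3 (pow_pos (norm_pos_iff.2 hε0) q)
    filter_upwards [hne] with ε hε x x' hx hx' hx1 hx2 hx1' hx2'
    by_cases hε0 : ε = 0
    · subst hε0
      have h3 : Tendsto (fun ε => ‖H (ε, x) - H (ε, x')‖) (𝓝[≠] 0) (𝓝 ‖H (0, x) - H (0, x')‖) :=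
        (((hHcont x).sub (hHcont x')).norm.tendsto).mono_left nhdsWithin_le_nhds
      refine le_of_tendsto h3 ?_
      filter_upwards [self_mem_nhdsWithin, mem_nhdsWithin_of_mem_nhds hne] with ε hε0 hε
      exact hε hε0 x x' hx hx' hx1 hx2 hx1' hx2'
    · exact hε hε0 x x' hx hx' hx1 hx2 hx1' hx2'
  have hHb' : ∀ τ > 0, ∀ᶠ ε in 𝓝 (0 : 𝕜), ‖H (ε, 0) - b 0‖ ≤ τ := fun τ hτ => by
    have h3 := (hHcont 0).tendsto
    simp only [hHb] at h3
    filter_upwards [h3.eventually (Metric.closedBall_mem_nhds _ hτ)] with ε hε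
    exact mem_closedBall_iff_norm.1 hε
  obtain ⟨η, hη, hηη₀, f, hf, hsol, huniq⟩ := exists_solution_of_hasSmallLipschitz
    (m := (m : WithTop ℕ∞)) (by exact_mod_cast hm) hη₀ hH hρ hρ1 hA (by positivity) hAM hSA hb₀
    hHlip hHb'
  have hSF : ∀ ε ν n, S ν + H (ε, (ν, n)) = F (ε, (ν, n)) := fun ε ν n => add_sub_cancel _ _
  simp only [hSF] at hsol huniq
  have hball : ∀ ε, ‖ε‖ < η → ε ∈ Metric.ball (0 : 𝕜) η₀ := fun ε hε =>
    mem_ball_zero_iff.2 (hε.trans_le hηη₀)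
  refine ⟨η, hη, hηη₀, f, hf, fun ε n hε hn => ⟨(hsol ε n hε hn).1, ?_⟩, fun C => ?_⟩
  · rw [← hgdef, hgdef, hgF ε (hball ε hε), (hsol ε n hε hn).2, smul_zero]
  · obtain ⟨η', hη', hη'η, huniq⟩ := huniq C
    refine ⟨η', hη', hη'η, fun ε ν n hε0 hε hn hν hνC => ?_⟩
    rw [← huniq ε ν n hε hn hν hνC, hgF ε (hball ε (hε.trans_le hη'η)), smul_eq_zero]
    simp [hε0]

end ConeSolutions

/-! ### Identification with the Jordan scheme -/

section Specialization

variable {𝕜 : Type*} [RCLike 𝕜]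
  {B : Type*} [NormedAddCommGroup B] [NormedSpace 𝕜 B]
  {B' : Type*} [NormedAddCommGroup B'] [NormedSpace 𝕜 B']
  {L : 𝕜 → B →L[𝕜] B'} {k : ℕ}

namespace JordanScheme

variable (T : JordanScheme L k)

lemma projLast_eq_projR [CompleteSpace B'] (hs : KSurjective L k) (y : B') :
    T.projLast hs y = T.projR hs (Fin.last k) y := by
  have hy : ∑ j, (T.projR hs j y : B') = y :=
    sum_sumProj T.isClosed_R T.indep_R (T.iSup_R_eq_top hs) y
  conv_lhs => rw [← hy, map_sum]
  rw [Finset.sum_eq_single (Fin.last k)]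
  · exact Submodule.projectionOnto_apply_left (T.isCompl_Rlast hs) _
  · intro j _ hj
    exact Submodule.projectionOnto_apply_of_mem_right (T.isCompl_Rlast hs)
      (le_iSup₂ (f := fun j (_ : j ≠ Fin.last k) => T.R j) j hj (T.projR hs j y).2)
  · simp

namespace ChainFamily

variable {T} (Φ : T.ChainFamily)

lemma contDiff_p (n : WithTop ℕ∞) : ContDiff 𝕜 n Φ.p := by
  have : Φ.p = fun ε => ∑ j : Fin (k + 1), ε ^ (j : ℕ) • Φ.φ j := rfl
  rw [this]
  fun_prop

/-- The isomorphism `S₁ ⊕ ⋯ ⊕ S_{k+1}` of `N₁ᶜ × ⋯ × N_{k+1}ᶜ` with `B'`. -/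
def leadEquiv [CompleteSpace B'] (hs : KSurjective L k) : ((j : Fin (k + 1)) → T.Nc j) ≃L[𝕜] B' :=
  (ContinuousLinearEquiv.piCongrRight Φ.S).trans
    (sumEquiv T.isClosed_R T.indep_R (T.iSup_R_eq_top hs))

lemma leadEquiv_apply [CompleteSpace B'] (hs : KSurjective L k) (ν : (j : Fin (k + 1)) → T.Nc j) :
    Φ.leadEquiv hs ν = ∑ j, (Φ.S j (ν j) : B') := by
  simp [leadEquiv, sumEquiv_apply]

/-- This explains why bounds on `P_{k+1}` and `S_{k+1}⁻¹` suffice: they control the only component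
of `S⁻¹` that cannot be dilated. -/
lemma leadEquiv_symm_apply_last [CompleteSpace B'] (hs : KSurjective L k) (y : B') :
    (Φ.leadEquiv hs).symm y (Fin.last k) = (Φ.S (Fin.last k)).symm (T.projLast hs y) := by
  rw [projLast_eq_projR]
  rfl

lemma conePoint_eq (z : 𝕜 → B) (s : ℕ) (ε : 𝕜) (ν : (j : Fin (k + 1)) → T.Nc j) (n : T.Nlast) :
    Φ.conePoint z s ε ν n = z ε + ε ^ s • Φ.p ε
      (coneVec (fun j => (T.Nc j).subtypeL) T.Nlast.subtypeL ε (ν, n)) := by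
  rw [coneVec_apply]
  rfl

end ChainFamily

end JordanScheme

lemma eventually_norm_le_mul_of_norm_deriv_lt {z : 𝕜 → B} (hz : DifferentiableAt 𝕜 z 0)
    (hz0 : z 0 = 0) {M : ℝ} (hM : ‖deriv z 0‖ < M) : ∀ᶠ ε in 𝓝 0, ‖z ε‖ ≤ M * ‖ε‖ := by
  have h1 := hz.hasDerivAt.isLittleO
  filter_upwards [h1.def (sub_pos.2 hM)] with ε hε
  simp only [hz0, sub_zero] at hε
  have h2 := norm_add_le (z ε - ε • deriv z 0) (ε • deriv z 0)
  rw [sub_add_cancel, norm_smul] at h2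
  nlinarith

end Specialization

end JordanNewton

end

/-! ### The main theorem: choice of constants -/

open JordanNewton in
theorem corollary4 {𝕜 : Type*} [RCLike 𝕜] (k i : ℕ) (hk : 2 ≤ k) (hi : 1 ≤ i) (hik : i ≤ k - 1)
    (M : ℝ) :
    ∃ δ > (0 : ℝ), ∃ ρ > (0 : ℝ),
      ∀ {B : Type*} [NormedAddCommGroup B] [NormedSpace 𝕜 B] [CompleteSpace B]
        {B' : Type*} [NormedAddCommGroup B'] [NormedSpace 𝕜 B'] [CompleteSpace B']
        (m : ℕ∞) (_ : 1 ≤ m)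
        (G : B → B') (_ : ContDiff 𝕜 ((m + (2 * k - i : ℕ) : ℕ∞) : WithTop ℕ∞) G)
        (U : Set 𝕜) (_ : IsOpen U) (_ : (0 : 𝕜) ∈ U)
        (z : 𝕜 → B) (_ : ContDiffOn 𝕜 ((m + (2 * k - i : ℕ) : ℕ∞) : WithTop ℕ∞) z U)
        (_ : z 0 = 0)
        (hsurj : KSurjective (linFamily G z) k)
        (T : JordanScheme (linFamily G z) k)
        (_ : ∀ j : ℕ, 2 ≤ j → j ≤ i + 1 → iteratedFDeriv 𝕜 j G 0 = 0)
        (b : 𝕜 → B') (_ : ContinuousAt b 0)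
        (_ : ∀ ε ∈ U, G (z ε) = ε ^ (2 * k - i) • b ε),
        Nonempty T.ChainFamily ∧
        ∀ (Φ : T.ChainFamily),
          ‖deriv z 0‖ ≤ M →
          ‖iteratedFDeriv 𝕜 (i + 2) G 0‖ ≤ M →
          (∀ y : B', ‖T.projLast hsurj y‖ ≤ M * ‖y‖) →
          (∀ y : T.Rlast, ‖(Φ.S (Fin.last k)).symm y‖ ≤ M * ‖y‖) →
          ‖T.projLast hsurj (b 0)‖ < δ →
          ∃ η > (0 : ℝ), Metric.ball (0 : 𝕜) η ⊆ U ∧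
            ∃ nbar : 𝕜 × T.Nlast → ((j : Fin (k + 1)) → T.Nc j),
              ContDiffOn 𝕜 (m : WithTop ℕ∞) nbar
                (Metric.ball (0 : 𝕜) η ×ˢ Metric.ball (0 : T.Nlast) ρ) ∧
              (∀ (ε : 𝕜) (n : T.Nlast), ‖ε‖ < η → ‖n‖ < ρ →
                ‖nbar (ε, n) (Fin.last k)‖ < ρ ∧
                G (Φ.conePoint z (k - i) ε (nbar (ε, n)) n) = 0) ∧
              ∀ C : ℝ, ∃ η' > (0 : ℝ), η' ≤ η ∧
                ∀ (ε : 𝕜) (ν : (j : Fin (k + 1)) → T.Nc j) (n : T.Nlast),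
                  ε ≠ 0 → ‖ε‖ < η' → ‖n‖ < ρ → ‖ν (Fin.last k)‖ < ρ → (∀ j, ‖ν j‖ ≤ C) →
                  (G (Φ.conePoint z (k - i) ε ν n) = 0 ↔ ν = nbar (ε, n)) := by
  -- The strict inequality `M < M₀` gives `‖z(ε)‖ ≤ M₀ ‖ε‖` near `0` from the bound on `z'(0)`; `M₀
  -- ≥ 1` gives `3ρ ≤ 1` below.
  obtain ⟨M₀, hM₀, hMM₀⟩ : ∃ M₀ : ℝ, 1 ≤ M₀ ∧ M < M₀ :=
    ⟨|M| + 1, by linarith [abs_nonneg M], by linarith [le_abs_self M]⟩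
  have hM₀' : 0 < M₀ := by linarith
  obtain ⟨s, hs, rfl⟩ : ∃ s, 1 ≤ s ∧ k = i + s := ⟨k - i, by omega, by omega⟩
  have hq : 2 * (i + s) - i = i + 2 * s := by omega
  have hs' : i + s - i = s := by omega
  simp only [hq, hs']
  -- With `A = M₀²` bounding the last component of `S⁻¹` and `M₀ + 3ρ ≤ M₀ + 1`, the factor `48 = 3
  -- · 16` yields `A κ ≤ 1/16`.
  set ρ : ℝ := 1 / (48 * M₀ ^ 2 * (M₀ + 1) ^ (i + 1)) with hρ
  have hρ0 : 0 < ρ := by positivity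
  have hpow : (1 : ℝ) ≤ (M₀ + 1) ^ (i + 1) := one_le_pow₀ (by linarith)
  have hsq : (1 : ℝ) ≤ M₀ ^ 2 := one_le_pow₀ hM₀
  have hρ3 : 3 * ρ ≤ 1 := by
    rw [hρ, mul_one_div, div_le_one (by positivity)]
    nlinarith [mul_le_mul hsq hpow zero_le_one (by positivity)]
  have hAM : M₀ ^ 2 * ((M₀ + 1) * (M₀ + 3 * ρ) ^ i * (3 * ρ)) ≤ 1 / 16 := by
    calc M₀ ^ 2 * ((M₀ + 1) * (M₀ + 3 * ρ) ^ i * (3 * ρ))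
        ≤ M₀ ^ 2 * ((M₀ + 1) * (M₀ + 1) ^ i * (3 * ρ)) := by gcongr
      _ = 1 / 16 := by rw [hρ]; field_simp; ring
  -- This `δ`, multiplied by the bound `M₀` for `S_{k+1}⁻¹`, leaves `ρ/16` for the last component of
  -- `S⁻¹ b(0)`.
  refine ⟨ρ / (16 * M₀), by positivity, ρ, hρ0, ?_⟩
  intro B _ _ _ B' _ _ _ m hm G hG U hU hU0 z hz hz0 hsurj T hG0 b hb hGz
  obtain ⟨η₀, hη₀, hηU⟩ := Metric.isOpen_iff.1 hU 0 hU0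
  have hz' := hz.mono hηU
  have hle : ∀ n : ℕ, n ≤ 1 + (i + 2 * s) →
      ((n : ℕ) : WithTop ℕ∞) ≤ ((m + (i + 2 * s : ℕ) : ℕ∞) : WithTop ℕ∞) := fun n hn => by
    have h : ((n : ℕ) : ℕ∞) ≤ m + (i + 2 * s : ℕ) :=
      (Nat.cast_le.2 hn).trans (by push_cast; gcongr)
    exact WithTop.coe_le_coe.2 h
  obtain ⟨a, ha⟩ := exists_hasExpansion_linFamily (k := i + s) hη₀ (hG.of_le (hle _ (by omega)))
    (hz'.of_le (hle _ (by omega)))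
  refine ⟨JordanScheme.nonempty_chainFamily ha hsurj, fun Φ hzM hGM hPM hSM hbδ => ?_⟩
  obtain ⟨r, hr, hG2⟩ := exists_norm_fderiv_fderiv_le (hG.of_le (hle _ (by omega))) hG0
    (hGM.trans hMM₀.le)
  have hzd : DifferentiableAt 𝕜 z 0 :=
    (hz.differentiableOn (fun h => absurd (h ▸ hle 1 (by omega)) (by simp))).differentiableAt
      (hU.mem_nhds hU0)
  have hS : ∀ y : T.Rlast, ‖(Φ.S (Fin.last _)).symm y‖ ≤ M₀ * ‖y‖ := fun y =>
    (hSM y).trans (by gcongr)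
  have hP : ∀ y : B', ‖T.projLast hsurj y‖ ≤ M₀ * ‖y‖ := fun y => (hPM y).trans (by gcongr)
  have : ∀ j, CompleteSpace (T.N j) := fun j => (T.isClosed_N j).completeSpace_coe
  obtain ⟨η, hη, hηη₀, f, hf, hf0, huniq⟩ := exists_cone_solutions (N := fun j => T.Nc j)
    (J := fun j => (T.Nc j).subtypeL) (J' := T.Nlast.subtypeL) (p := Φ.p)
    (σ := fun j => (T.R j).subtypeL ∘L (Φ.S j : T.Nc j →L[𝕜] T.R j)) (S := Φ.leadEquiv hsurj)
    hs rfl (by rintro rfl; simp at hm) hG hη₀ hz' hb (fun ε hε => hGz ε (hηU hε)) hr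
    (by positivity) hM₀'.le hG2
    (eventually_norm_le_mul_of_norm_deriv_lt hzd hz0 (hzM.trans_lt hMM₀))
    (fun j x => le_rfl) (fun x => le_rfl) Φ.contDiff_p Φ.p_zero (Φ.leadEquiv_apply hsurj)
    (Φ.chain_opNorm ha) (Φ.chain_last_opNorm ha) hρ0 (by linarith) (by positivity) hAM
    (fun v => by
      rw [Φ.leadEquiv_symm_apply_last]
      calc _ ≤ M₀ * ‖T.projLast hsurj v‖ := hS _
        _ ≤ M₀ * (M₀ * ‖v‖) := by gcongr; exact hP v
        _ = M₀ ^ 2 * ‖v‖ := by ring)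
    (by
      rw [Φ.leadEquiv_symm_apply_last]
      calc _ ≤ M₀ * ‖T.projLast hsurj (b 0)‖ := hS _
        _ ≤ M₀ * (ρ / (16 * M₀)) := by gcongr
        _ = ρ / 16 := by field_simp)
  refine ⟨η, hη, (Metric.ball_subset_ball hηη₀).trans hηU, f, hf, fun ε n hε hn => ?_,
    fun C => ?_⟩
  · rw [Φ.conePoint_eq]
    exact hf0 ε n hε hn
  · obtain ⟨η', hη', hle', h⟩ := huniq C
    refine ⟨η', hη', hle', fun ε ν n h0 hε hn hν hC => ?_⟩
    rw [Φ.conePoint_eq]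
    exact h ε ν n h0 hε hn hν hC
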